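/- **Setting.** Let $\alpha\ge 0$ and let $\gamma=(\gamma_j)_{j\ge1}$ be a non-increasing sequence with $0<\gamma_j\le 1$. For $d\in\mathbb N=\{1,2,\dots\}$ and $h\in\mathbb Z^d$ put $r(h)=\prod_{j=1}^d r_j(h_j)$, where $r_j(0)=1$ and $r_j(k)=\max\{1,|k|^\alpha/\gamma_j\}$ for $k\ne 0$. Let $\mathcal H_{d,\alpha,\gamma}$ be the space of square integrable functions $f:[0,1]^d\to\mathbb C$ with $$\|f\|_{d,\alpha,\gamma}=\Big(\sum_{h\in\mathbb Z^d}|r(h)\hat f(h)|^2\Big)^{1/2}<\infty,\qquad \hat f(h)=\int_{[0,1]^d}f(x)e^{-2\pi i h\cdot x}\,dx,$$ where for $\alpha>1/2$ the functions are taken to be continuous. Let $I_d(f)=\int_{[0,1]^d}f(x)\,dx$. A randomized algorithm using at most $n$ function evaluations is a family $(A_\omega)$, indexed by a probability space, of deterministic, possibly adaptive, algorithms, each of which computes $A_\omega(f)\in\mathbb C$ from $n$ function values of $f$, such that $\omega\mapsto A_\omega(f)$ is a random variable for every $f\in\mathcal H_{d,\alpha,\gamma}$. Its randomized error is $\sup_{\|f\|_{d,\alpha,\gamma}\le1}\mathbb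 E\,|A_\omega(f)-I_d(f)|$. For $\varepsilon\in(0,1)$ let $n(\varepsilon,d)$ be the minimal $n$ for which some randomized algorithm using at most $n$ function evaluations has randomized error at most $\varepsilon$. The integration problem is strongly tractable in the randomized setting if there are $p\ge0$ and $C>0$ with $n(\varepsilon,d)\le C\varepsilon^{-p}$ for all $\varepsilon\in(0,1)$ and all $d\in\mathbb N$; the infimum of all such $p$ is the exponent of strong tractability. **Theorem.** Let $\lambda_0\in[0,\infty]$ be the supremum of the numbers $\lambda>0$ such that $\sum_{j=1}^\infty\gamma_j^{1/\lambda}<\infty$, with $\lambda_0=0$ if there is no such $\lambda$ (and with $1/(\lambda_0+1/2)=0$ if $\lambda_0=\infty$). Then integration in the spaces $\mathcal H_{d,\alpha,\gamma}$, $d\in\mathbb N$, is strongly tractable in the randomized setting, and the exponent of strong tractability lies in the interval $$\left[\frac1{\alpha+1/2},\ \max\left\{\frac1{\lambda_0+1/2},\frac1{\alpha+1/2}\right\}\right].$$ In particular, if $\lambda_0\ge\alpha$, then the exponent of strong tractability equals $1/(\alpha+1/2)$. -/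

import Mathlib

open MeasureTheory
open scoped ENNReal NNReal

noncomputable section

namespace WeightedIntegration

/-- The unit cube `[0,1]^d` (with the product Lebesgue measure as its `volume`). -/
abbrev Cube (d : ℕ) : Type := Fin d → unitInterval

/-- The integral `I_d(f)` of `f` over the unit cube. -/
def cubeIntegral {d : ℕ} (f : Cube d → ℂ) : ℂ := ∫ x, f x

/-- The Fourier coefficient `∫ f(x) exp(-2πi h·x) dx` over the unit cube. -/
def fourierCoefficient {d : ℕ} (f : Cube d → ℂ) (h : Fin d → ℤ) : ℂ :=
  ∫ x : Cube d,
    f x * Complex.exp (-(2 * Real.pi * Complex.I * ∑ j, (h j : ℂ) * ((x j : ℝ) : ℂ)))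

/-- The one-dimensional weight function `max {1, |h|^α / γ}`. The value at `h = 0` is `1`, for
`α = 0` as well (so `0^0` is not read as `1` here). -/
def weight₁ (α γ : ℝ) (h : ℤ) : ℝ :=
  if h = 0 then 1 else max 1 (|(h : ℝ)| ^ α / γ)

/-- The product weight function. The weight of the first coordinate is `γ 0`. -/
def weight (α : ℝ) (γ : ℕ → ℝ) {d : ℕ} (h : Fin d → ℤ) : ℝ :=
  ∏ j : Fin d, weight₁ α (γ j) (h j)

/-- The norm `(∑_h |r(h) f̂(h)|²)^{1/2}`, with value `∞` if the series diverges. -/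
def sobolevNorm (α : ℝ) (γ : ℕ → ℝ) {d : ℕ} (f : Cube d → ℂ) : ℝ≥0∞ :=
  (∑' h : Fin d → ℤ,
    (ENNReal.ofReal (weight α γ h) * ‖fourierCoefficient f h‖ₑ) ^ 2) ^ (1 / 2 : ℝ)

/-- The weighted Sobolev space of dominating mixed smoothness `α`: square integrable functions on
the cube with finite norm. For `α > 1/2` its elements are the continuous representatives. -/
def sobolevSpace (d : ℕ) (α : ℝ) (γ : ℕ → ℝ) : Set (Cube d → ℂ) :=
  {f | MemLp f 2 volume ∧ sobolevNorm α γ f < ∞ ∧ (1 / 2 < α → Continuous f)}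

/-- A deterministic, possibly adaptive, algorithm based on function values: `node` chooses the next
sampling point from the list of function values already obtained, and `output` computes the result
from the list of all function values. -/
structure SamplingAlgorithm (d : ℕ) where
  node : List ℂ → Cube d
  output : List ℂ → ℂ

namespace SamplingAlgorithm

/-- The list of the first `n` function values that the algorithm obtains on input `f`. -/
def samples {d : ℕ} (A : SamplingAlgorithm d) (f : Cube d → ℂ) : ℕ → List ℂ
  | 0 => []
  | n + 1 => A.samples f n ++ [f (A.node (A.samples f n))]

/-- The result of the algorithm on input `f` after `n` function evaluations. -/
def result {d : ℕ} (A : SamplingAlgorithm d) (n : ℕ) (f : Cube d → ℂ) : ℂ :=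
  A.output (A.samples f n)

end SamplingAlgorithm

/-- A randomized algorithm on the class `F` that uses (at most) `n` function evaluations: a family
of deterministic algorithms, indexed by a probability space, whose result is a random variable for
every input from `F`. -/
structure RandomizedAlgorithm (d n : ℕ) (F : Set (Cube d → ℂ)) where
  Ω : Type
  measurableSpace : MeasurableSpace Ω
  P : Measure Ω
  isProbabilityMeasure : IsProbabilityMeasure P
  algorithm : Ω → SamplingAlgorithm d
  aemeasurable_result : ∀ f ∈ F, AEMeasurable (fun ω => (algorithm ω).result n f) P

/-- The randomized (worst case) error of a randomized algorithm over the unit ball of the weighted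
Sobolev space: the supremum over `f` of `𝔼 |A(f) - I_d(f)|`. -/
def randomizedError {d n : ℕ} (α : ℝ) (γ : ℕ → ℝ)
    (A : RandomizedAlgorithm d n (sobolevSpace d α γ)) : ℝ≥0∞ :=
  ⨆ f ∈ {f | f ∈ sobolevSpace d α γ ∧ sobolevNorm α γ f ≤ 1},
    @lintegral A.Ω A.measurableSpace A.P
      (fun ω => ‖(A.algorithm ω).result n f - cubeIntegral f‖ₑ)

/-- The information complexity `n(ε, d)`: the least number of function evaluations with which some
randomized algorithm has randomized error at most `ε` (`∞` if there is none). -/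
def informationComplexity (α : ℝ) (γ : ℕ → ℝ) (ε : ℝ) (d : ℕ) : ℕ∞ :=
  ⨅ n ∈ {n : ℕ | ∃ A : RandomizedAlgorithm d n (sobolevSpace d α γ),
    randomizedError α γ A ≤ ENNReal.ofReal ε}, (n : ℕ∞)

/-- `n(ε, d) ≤ C ε^{-p}` for all `d ≥ 1` and `ε ∈ (0,1)`, with `C` independent of `ε` and `d`. -/
def ComplexityBound (α : ℝ) (γ : ℕ → ℝ) (p : ℝ≥0) : Prop :=
  ∃ C : ℝ, 0 < C ∧ ∀ d : ℕ, 1 ≤ d → ∀ ε : ℝ, 0 < ε → ε < 1 →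
    (informationComplexity α γ ε d : ℝ≥0∞) ≤ ENNReal.ofReal (C * ε ^ (-(p : ℝ)))

/-- Strong tractability of integration in the randomized setting. -/
def StronglyTractable (α : ℝ) (γ : ℕ → ℝ) : Prop :=
  ∃ p : ℝ≥0, ComplexityBound α γ p

/-- The exponent of strong tractability: the infimum of the admissible `p` (`∞` if none). -/
def strongTractabilityExponent (α : ℝ) (γ : ℕ → ℝ) : ℝ≥0∞ :=
  ⨅ p ∈ {p : ℝ≥0 | ComplexityBound α γ p}, (p : ℝ≥0∞)

/-- The supremum `λ₀ ∈ [0,∞]` of the numbers `l > 0` with `∑_j γ_j^{1/l} < ∞`; it is `0` if there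
is no such `l`. -/
def summabilityIndex (γ : ℕ → ℝ) : ℝ≥0∞ :=
  ⨆ l ∈ {l : ℝ | 0 < l ∧ Summable (fun j => γ j ^ (1 / l))}, ENNReal.ofReal l

end WeightedIntegration

end

/-! Upper bound. The algorithm is a lattice rule on the torus with a random real generator `z` and a
uniform random shift. Its nodes are the translates of `i • z` for `i < K * m`, weighted by the
`K`-fold convolution of the uniform distribution on `{0, …, m - 1}`. In Fourier space it multiplies
the coefficient at `h` by `avgChar m h z ^ K`. Hence, by Parseval, the mean square error over the
shift is the sum over `h ≠ 0` of `|avgChar|^(2K) |f̂(h)|²`. For uniform `z` and `h ≠ 0` the mean of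
`|avgChar|²` is exactly `1/m`, which already gives the Monte Carlo rate `m^(-1/2)` for `K = 1`.

For smoothness `l < α` with `∑ γ_j^(1/l) < ∞`, the sum of `r(h)^(-1/l)` is bounded by some `A`
uniformly in `d`. By Markov and a union bound, with probability at least `1/2` all `h ≠ 0` satisfy
`|avgChar|² ≤ 2A r(h)^(1/l) / m`. With `z` conditioned on this event, one factor `|avgChar|²` is
still averaged to at most `2/m`, while the other `K - 1 ≥ 2l` factors are at most `(2A/m)^(2l)
r(h)²` pointwise. The weight `r(h)²` is absorbed by the norm of `f`, and the error is `O(m^(-(l +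
1/2)))` with a constant free of `d`. Letting `l` tend to `min(λ₀, α)` gives the upper end of the
interval.

Lower bound. Dimension one suffices. Take `N ≈ 2n` disjoint bumps of width `1/N` and height of order
`N^(-α)` with independent random signs. An adaptive deterministic algorithm touches at most `n` of
them, and the set it misses is unaffected by the signs inside that set. Flipping these signs leaves
the output unchanged but moves the integral, on average by order `√N · N^(-α-1)`; this first moment
is bounded below through the second and fourth moments (`DependsOnComplement.sum_abs_ge`). Averaging
over the signs transfers the bound `n^(-(α + 1/2))` to randomized algorithms. -/

noncomputable section

namespace WeightedIntegration

/-! ### Fourier analysis on the cube, transported from the torus -/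

open UnitAddTorus

/-- The normalised Haar measure on the `d`-dimensional torus. -/
def torusMeasure (d : ℕ) : Measure (UnitAddTorus (Fin d)) :=
  Measure.pi fun _ => AddCircle.haarAddCircle

instance (d : ℕ) : IsProbabilityMeasure (torusMeasure d) := by
  unfold torusMeasure; infer_instance

instance (d : ℕ) : (torusMeasure d).IsAddLeftInvariant := by
  unfold torusMeasure; infer_instance

/-- The Fourier coefficients of a function on the torus. -/
def torusCoeff {d : ℕ} (G : UnitAddTorus (Fin d) → ℂ) (h : Fin d → ℤ) : ℂ :=
  ∫ x, mFourier (-h) x * G x ∂torusMeasure d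

/-- The representative in `[0,1]` of a point of the circle. -/
def circleRep (x : UnitAddCircle) : unitInterval :=
  ⟨AddCircle.equivIoc 1 0 x, by
    have := (AddCircle.equivIoc (1 : ℝ) 0 x).2
    exact ⟨this.1.le, by simpa using this.2⟩⟩

/-- The half-open and the closed unit interval differ by a null set. Passing to the torus makes
translations measure preserving; continuity of the transported functions is never needed. -/
theorem measurePreserving_circleRep :
    MeasurePreserving circleRep AddCircle.haarAddCircle volume := by
  have h1 : (AddCircle.haarAddCircle : Measure UnitAddCircle) = volume := by
    rw [AddCircle.volume_eq_smul_haarAddCircle]; simp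
  rw [h1]
  have h2 := AddCircle.measurePreserving_equivIoc 1 (a := (0 : ℝ))
  have hm : Measurable circleRep :=
    (measurable_subtype_coe.comp h2.measurable).subtype_mk
  refine ⟨hm, ?_⟩
  ext s hs
  rw [Measure.map_apply hm hs]
  obtain ⟨t, ht, rfl⟩ := hs
  have e1 : circleRep ⁻¹' (Subtype.val ⁻¹' t) =
      (AddCircle.equivIoc (1 : ℝ) 0) ⁻¹' (Subtype.val ⁻¹' t) := rfl
  rw [e1, h2.measure_preimage (measurable_subtype_coe ht).nullMeasurableSet,
    comap_subtype_coe_apply measurableSet_Ioc, unitInterval.volume_apply,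
    Subtype.image_preimage_coe, Subtype.image_preimage_coe]
  refine measure_congr ?_
  have : (Set.Ioc (0 : ℝ) (0 + 1)) =ᵐ[volume] unitInterval := by
    simpa [unitInterval] using (Ioc_ae_eq_Icc (μ := (volume : Measure ℝ)) (a := (0 : ℝ)) (b := 1))
  exact this.inter (Filter.EventuallyEq.rfl)

/-- The representative in `[0,1]^d` of a point of the torus. -/
def torusRep {d : ℕ} (x : UnitAddTorus (Fin d)) : Cube d := fun j => circleRep (x j)

theorem measurePreserving_torusRep (d : ℕ) :
    MeasurePreserving (torusRep (d := d)) (torusMeasure d) volume :=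
  measurePreserving_pi _ _ fun _ => measurePreserving_circleRep

theorem mFourier_neg_eq_exp {d : ℕ} (h : Fin d → ℤ) (x : UnitAddTorus (Fin d)) :
    mFourier (-h) x = Complex.exp (-(2 * Real.pi * Complex.I *
      ∑ j, (h j : ℂ) * ((torusRep x j : ℝ) : ℂ))) := by
  rw [Finset.mul_sum, ← Finset.sum_neg_distrib, Complex.exp_sum]
  change ∏ j, fourier ((-h) j) (x j) = _
  refine Finset.prod_congr rfl fun j _ => ?_
  have : x j = ((torusRep x j : ℝ) : UnitAddCircle) :=
    ((AddCircle.equivIoc (1 : ℝ) 0).symm_apply_apply (x j)).symm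
  conv_lhs => rw [this]
  rw [fourier_coe_apply]
  congr 1
  push_cast [Pi.neg_apply]
  ring

theorem torusCoeff_comp_torusRep {d : ℕ} {f : Cube d → ℂ} (hf : AEStronglyMeasurable f volume)
    (h : Fin d → ℤ) : torusCoeff (f ∘ torusRep) h = fourierCoefficient f h := by
  unfold torusCoeff fourierCoefficient
  have hmp := measurePreserving_torusRep d
  rw [← hmp.map_eq, integral_map hmp.measurable.aemeasurable]
  · refine integral_congr_ae (.of_forall fun x => ?_)
    simp only [Function.comp_apply, mFourier_neg_eq_exp, mul_comm]
  · rw [hmp.map_eq]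
    refine hf.mul (Continuous.aestronglyMeasurable ?_)
    fun_prop

theorem tsum_enorm_sq_torusCoeff {d : ℕ} {G : UnitAddTorus (Fin d) → ℂ}
    (hG : MemLp G 2 (torusMeasure d)) :
    ∑' h, ‖torusCoeff G h‖ₑ ^ 2 = ∫⁻ x, ‖G x‖ₑ ^ 2 ∂torusMeasure d := by
  have hs := hasSum_sq_mFourierCoeff (d := Fin d) (hG.toLp G)
  have hae := hG.coeFn_toLp
  have hc : ∀ h, mFourierCoeff (hG.toLp G) h = torusCoeff G h := fun h => by
    refine integral_congr_ae ?_
    filter_upwards [hae] with x hx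
    rw [hx, smul_eq_mul]
  have hi : ∫ t, ‖(hG.toLp G) t‖ ^ 2 ∂torusMeasure d = ∫ t, ‖G t‖ ^ 2 ∂torusMeasure d := by
    refine integral_congr_ae ?_
    filter_upwards [hae] with x hx
    rw [hx]
  replace hs : HasSum (fun h => ‖torusCoeff G h‖ ^ 2) (∫ t, ‖G t‖ ^ 2 ∂torusMeasure d) := by
    rw [← hi, ← funext fun h => congrArg (fun z => ‖z‖ ^ 2) (hc h)]; exact hs
  have hint : Integrable (fun t => ‖G t‖ ^ 2) (torusMeasure d) := by
    have := hG.integrable_norm_pow (by norm_num)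
    simpa using this
  calc ∑' h, ‖torusCoeff G h‖ₑ ^ 2 = ∑' h, ENNReal.ofReal (‖torusCoeff G h‖ ^ 2) := by
        refine tsum_congr fun h => ?_
        rw [ENNReal.ofReal_pow (norm_nonneg _), ofReal_norm]
    _ = ENNReal.ofReal (∫ t, ‖G t‖ ^ 2 ∂torusMeasure d) := by
        rw [← ENNReal.ofReal_tsum_of_nonneg (fun _ => by positivity) hs.summable, hs.tsum_eq]
    _ = ∫⁻ t, ENNReal.ofReal (‖G t‖ ^ 2) ∂torusMeasure d :=
        ofReal_integral_eq_lintegral_ofReal hint (.of_forall fun _ => by positivity)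
    _ = _ := by
        refine lintegral_congr fun x => ?_
        rw [ENNReal.ofReal_pow (norm_nonneg _), ofReal_norm]

/-- Parseval's identity on the cube. -/
theorem tsum_enorm_sq_fourierCoefficient {d : ℕ} {f : Cube d → ℂ} (hf : MemLp f 2 volume) :
    ∑' h, ‖fourierCoefficient f h‖ₑ ^ 2 = ∫⁻ x, ‖f x‖ₑ ^ 2 := by
  have hmp := measurePreserving_torusRep d
  simp only [← torusCoeff_comp_torusRep hf.1]
  rw [tsum_enorm_sq_torusCoeff (hf.comp_measurePreserving hmp), ← hmp.map_eq,
    lintegral_map' _ hmp.measurable.aemeasurable]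
  · rfl
  · rw [hmp.map_eq]; exact hf.1.enorm.pow_const 2

theorem cubeIntegral_eq_fourierCoefficient {d : ℕ} (f : Cube d → ℂ) :
    cubeIntegral f = fourierCoefficient f 0 := by
  simp [cubeIntegral, fourierCoefficient]

/-! ### Characters and their averages along multiples of a generator -/

theorem mFourier_apply_add {d : ℕ} (h : Fin d → ℤ) (x y : UnitAddTorus (Fin d)) :
    mFourier h (x + y) = mFourier h x * mFourier h y := by
  simp [mFourier, Finset.prod_mul_distrib, fourier_apply, AddCircle.toCircle_add, smul_add]

theorem mFourier_apply_nsmul {d : ℕ} (h : Fin d → ℤ) (k : ℕ) (x : UnitAddTorus (Fin d)) :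
    mFourier h (k • x) = mFourier h x ^ k := by
  induction k with
  | zero => simp [mFourier]
  | succ k ih => rw [succ_nsmul, mFourier_apply_add, ih, pow_succ]

theorem mFourier_smul_apply {d : ℕ} (h : Fin d → ℤ) (k : ℕ) (x : UnitAddTorus (Fin d)) :
    mFourier ((k : ℤ) • h) x = mFourier h x ^ k := by
  induction k with
  | zero => simp [mFourier_zero]
  | succ k ih => rw [Nat.cast_succ, add_smul, one_smul, mFourier_add, ih, pow_succ]

theorem norm_mFourier_apply {d : ℕ} (h : Fin d → ℤ) (x : UnitAddTorus (Fin d)) :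
    ‖mFourier h x‖ = 1 := by
  simp only [mFourier, ContinuousMap.coe_mk, norm_prod, fourier_apply, Circle.norm_coe,
    Finset.prod_const_one]

theorem integral_mFourier {d : ℕ} (h : Fin d → ℤ) :
    ∫ x, mFourier h x ∂torusMeasure d = if h = 0 then 1 else 0 := by
  have := orthonormal_iff_ite.1 (orthonormal_mFourier (d := Fin d)) 0 h
  rw [ContinuousMap.inner_toLp] at this
  simp only [← mFourier_neg, ← mFourier_add, neg_zero, add_zero, eq_comm (a := (0 : Fin d → ℤ))]
    at this
  exact this

theorem torusCoeff_translate {d : ℕ} (G : UnitAddTorus (Fin d) → ℂ) (a : UnitAddTorus (Fin d))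
    (h : Fin d → ℤ) :
    torusCoeff (fun x => G (a + x)) h = mFourier h a * torusCoeff G h := by
  unfold torusCoeff
  rw [← integral_const_mul,
    ← integral_add_left_eq_self (fun x => mFourier h a * (mFourier (-h) x * G x)) a]
  refine integral_congr_ae (.of_forall fun x => ?_)
  simp only [mFourier_apply_add]
  have : mFourier h a * mFourier (-h) a = 1 := by
    rw [← mFourier_add]; simp [mFourier_zero]
  linear_combination (-(mFourier (-h) x * G (a + x))) * this

/-- The average of the character `mFourier h` over the multiples `0, z, …, (m - 1) z`. -/
def avgChar {d : ℕ} (m : ℕ) (h : Fin d → ℤ) (z : UnitAddTorus (Fin d)) : ℂ :=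
  ∑ i : Fin m, (m : ℂ)⁻¹ * mFourier h z ^ (i : ℕ)

theorem continuous_avgChar {d : ℕ} (m : ℕ) (h : Fin d → ℤ) :
    Continuous (avgChar (d := d) m h) := by
  unfold avgChar; fun_prop

theorem norm_avgChar_le_one {d m : ℕ} (h : Fin d → ℤ) (z : UnitAddTorus (Fin d)) :
    ‖avgChar m h z‖ ≤ 1 := by
  refine (norm_sum_le _ _).trans ?_
  simp only [norm_mul, norm_pow, norm_mFourier_apply, one_pow, mul_one, norm_inv,
    Complex.norm_natCast, Finset.sum_const, Finset.card_univ, Fintype.card_fin, nsmul_eq_mul]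
  exact mul_inv_le_one

theorem integral_norm_sq_avgChar {d m : ℕ} (hm : 0 < m) {h : Fin d → ℤ} (hh : h ≠ 0) :
    ∫ z, ‖avgChar m h z‖ ^ 2 ∂torusMeasure d = (m : ℝ)⁻¹ := by
  -- The square expands into characters of frequency `(i - j) • h`; as `h ≠ 0`, only the `m`
  -- diagonal terms survive integration.
  have key : ∀ z, ((‖avgChar m h z‖ ^ 2 : ℝ) : ℂ) =
      ∑ i : Fin m, ∑ j : Fin m, (m : ℂ)⁻¹ ^ 2 * mFourier (((i : ℤ) - (j : ℤ)) • h) z := fun z => by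
    rw [Complex.ofReal_pow, ← Complex.mul_conj', avgChar, map_sum, Finset.sum_mul_sum]
    refine Finset.sum_congr rfl fun i _ => Finset.sum_congr rfl fun j _ => ?_
    rw [sub_smul, sub_eq_add_neg, mFourier_add, mFourier_neg, mFourier_smul_apply,
      mFourier_smul_apply]
    simp only [map_mul, map_pow, map_inv₀, Complex.conj_natCast]
    ring
  rw [← Complex.ofReal_inj, ← integral_complex_ofReal]
  have hi : ∀ g : Fin d → ℤ, Integrable (fun z => (m : ℂ)⁻¹ ^ 2 * mFourier g z) (torusMeasure d) :=
    fun g => (Continuous.integrable_of_hasCompactSupport (by fun_prop)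
      (HasCompactSupport.of_compactSpace _)).const_mul _
  refine (integral_congr_ae (.of_forall key)).trans ?_
  rw [integral_finsetSum _ fun i _ => integrable_finsetSum _ fun j _ => hi _]
  have : ∀ i j : Fin m, (((i : ℤ) - (j : ℤ)) • h = 0) ↔ i = j := fun i j => by
    rw [smul_eq_zero, or_iff_left hh, sub_eq_zero, Nat.cast_inj, Fin.ext_iff]
  simp only [integral_finsetSum _ fun j _ => hi _, integral_const_mul, integral_mFourier, this]
  have hm' : (m : ℂ) ≠ 0 := by exact_mod_cast hm.ne'
  simp
  field_simp

theorem lintegral_enorm_sq_avgChar {d m : ℕ} (hm : 0 < m) {h : Fin d → ℤ} (hh : h ≠ 0) :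
    ∫⁻ z, ‖avgChar m h z‖ₑ ^ 2 ∂torusMeasure d = (m : ℝ≥0∞)⁻¹ := by
  have hi : Integrable (fun z => ‖avgChar m h z‖ ^ 2) (torusMeasure d) :=
    Continuous.integrable_of_hasCompactSupport ((continuous_avgChar m h).norm.pow 2)
      (HasCompactSupport.of_compactSpace _)
  have := ofReal_integral_eq_lintegral_ofReal hi (.of_forall fun _ => by positivity)
  rw [integral_norm_sq_avgChar hm hh, ENNReal.ofReal_inv_of_pos (by exact_mod_cast hm),
    ENNReal.ofReal_natCast] at this
  rw [this]
  refine lintegral_congr fun x => ?_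
  rw [ENNReal.ofReal_pow (norm_nonneg _), ofReal_norm]

/-! ### Randomized lattice rules and their mean square error -/

/-- The lattice rule with generator `z`, shift `x` and the weights of the `K`-fold convolution of
the uniform distribution on `{0, …, m - 1}`. -/
def latticeRule {d : ℕ} (K m : ℕ) (G : UnitAddTorus (Fin d) → ℂ) (z x : UnitAddTorus (Fin d)) :
    ℂ :=
  ∑ t : Fin K → Fin m, (m : ℂ)⁻¹ ^ K * G ((∑ k, (t k : ℕ)) • z + x)

theorem memLp_latticeRule {d : ℕ} (K m : ℕ) {G : UnitAddTorus (Fin d) → ℂ}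
    (hG : MemLp G 2 (torusMeasure d)) (z : UnitAddTorus (Fin d)) :
    MemLp (latticeRule K m G z) 2 (torusMeasure d) := by
  unfold latticeRule
  exact memLp_finsetSum _ fun t _ =>
    (hG.comp_measurePreserving (measurePreserving_add_left (torusMeasure d) _)).const_mul _

/-- Translation by `k • z` multiplies the coefficient by the `k`-th power of the character, and
convolution of weights becomes multiplication: expanding the `K`-th power of `avgChar` gives the sum
over `t`. -/
theorem torusCoeff_latticeRule {d : ℕ} (K m : ℕ) {G : UnitAddTorus (Fin d) → ℂ}
    (hG : MemLp G 2 (torusMeasure d)) (z : UnitAddTorus (Fin d)) (h : Fin d → ℤ) :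
    torusCoeff (latticeRule K m G z) h = avgChar m h z ^ K * torusCoeff G h := by
  have hi : ∀ a, Integrable (fun x => mFourier (-h) x * G (a + x)) (torusMeasure d) := fun a => by
    have h1 := (hG.comp_measurePreserving (measurePreserving_add_left (torusMeasure d) a))
    refine (h1.integrable (by norm_num)).bdd_mul (c := 1) ?_ ?_
    · exact Continuous.aestronglyMeasurable (by fun_prop)
    · exact .of_forall fun x => (norm_mFourier_apply _ _).le
  calc torusCoeff (latticeRule K m G z) h
      = ∫ x, ∑ t : Fin K → Fin m, (m : ℂ)⁻¹ ^ K *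
          (mFourier (-h) x * G ((∑ k, (t k : ℕ)) • z + x)) ∂torusMeasure d := by
        refine integral_congr_ae (.of_forall fun x => ?_)
        simp only [latticeRule, Finset.mul_sum]
        exact Finset.sum_congr rfl fun t _ => by ring
    _ = ∑ t : Fin K → Fin m, (m : ℂ)⁻¹ ^ K *
          (mFourier h z ^ (∑ k, (t k : ℕ)) * torusCoeff G h) := by
        rw [integral_finsetSum _ fun t _ => (hi _).const_mul _]
        refine Finset.sum_congr rfl fun t _ => ?_
        rw [integral_const_mul, ← mFourier_apply_nsmul, ← torusCoeff_translate]
        rfl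
    _ = _ := by
        rw [avgChar, Fintype.sum_pow, Finset.sum_mul]
        refine Finset.sum_congr rfl fun t _ => ?_
        rw [Finset.prod_mul_distrib, Finset.prod_pow_eq_pow_sum]
        simp [mul_assoc]

theorem torusCoeff_sub_const {d : ℕ} {G : UnitAddTorus (Fin d) → ℂ}
    (hG : MemLp G 2 (torusMeasure d)) (c : ℂ) (h : Fin d → ℤ) :
    torusCoeff (fun x => G x - c) h = torusCoeff G h - if h = 0 then c else 0 := by
  have h1 : Integrable (fun x => mFourier (-h) x * G x) (torusMeasure d) :=
    (hG.integrable (by norm_num)).bdd_mul (c := 1)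
      (Continuous.aestronglyMeasurable (by fun_prop))
      (.of_forall fun x => (norm_mFourier_apply _ _).le)
  have h2 : Integrable (fun x => mFourier (-h) x * c) (torusMeasure d) :=
    (Continuous.integrable_of_hasCompactSupport (by fun_prop)
      (HasCompactSupport.of_compactSpace _))
  simp only [torusCoeff, mul_sub]
  rw [integral_sub h1 h2, integral_mul_const, integral_mFourier]
  simp [neg_eq_zero]

theorem avgChar_zero {d m : ℕ} (hm : 0 < m) (z : UnitAddTorus (Fin d)) : avgChar m 0 z = 1 := by
  have : (m : ℂ) ≠ 0 := by exact_mod_cast hm.ne'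
  simp [avgChar, mFourier_zero, this]

theorem lintegral_enorm_sq_latticeRule_sub {d K m : ℕ} (hm : 0 < m)
    {G : UnitAddTorus (Fin d) → ℂ} (hG : MemLp G 2 (torusMeasure d)) (z : UnitAddTorus (Fin d)) :
    ∫⁻ x, ‖latticeRule K m G z x - torusCoeff G 0‖ₑ ^ 2 ∂torusMeasure d =
      ∑' h : Fin d → ℤ, if h = 0 then 0 else
        (‖avgChar m h z‖ₑ ^ K * ‖torusCoeff G h‖ₑ) ^ 2 := by
  have hL := memLp_latticeRule K m hG z
  refine (tsum_enorm_sq_torusCoeff (hL.sub (memLp_const (torusCoeff G 0)))).symm.trans ?_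
  refine tsum_congr fun h => ?_
  have : torusCoeff ((latticeRule K m G z) - fun _ => torusCoeff G 0) h = _ :=
    torusCoeff_sub_const hL (torusCoeff G 0) h
  rw [this, torusCoeff_latticeRule K m hG]
  split_ifs with h0
  · subst h0; simp [avgChar_zero hm]
  · simp [enorm_mul, enorm_pow]

/-- The uniform shift makes every single node uniform, whatever the law of the generator. So an
almost everywhere measurable integrand yields an almost everywhere measurable output. -/
theorem measurePreserving_nsmul_add {d : ℕ} (μ : Measure (UnitAddTorus (Fin d)))
    [IsProbabilityMeasure μ] (k : ℕ) :
    MeasurePreserving (fun p : UnitAddTorus (Fin d) × UnitAddTorus (Fin d) => k • p.1 + p.2)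
      (μ.prod (torusMeasure d)) (torusMeasure d) := by
  have h1 : MeasurePreserving (fun p : UnitAddTorus (Fin d) × UnitAddTorus (Fin d) =>
      (id p.1, k • p.1 + p.2)) (μ.prod (torusMeasure d)) (μ.prod (torusMeasure d)) := by
    refine (MeasurePreserving.id μ).skew_product (g := fun z x => k • z + x) ?_ ?_
    · exact Continuous.measurable (by fun_prop)
    · exact .of_forall fun z => (measurePreserving_add_left (torusMeasure d) (k • z)).map_eq
  exact measurePreserving_snd.comp h1

theorem aestronglyMeasurable_latticeRule {d : ℕ} (K m : ℕ) {G : UnitAddTorus (Fin d) → ℂ}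
    (hG : AEStronglyMeasurable G (torusMeasure d)) (μ : Measure (UnitAddTorus (Fin d)))
    [IsProbabilityMeasure μ] :
    AEStronglyMeasurable (fun p : UnitAddTorus (Fin d) × UnitAddTorus (Fin d) =>
      latticeRule K m G p.1 p.2) (μ.prod (torusMeasure d)) := by
  unfold latticeRule
  exact Finset.aestronglyMeasurable_fun_sum _ fun t _ =>
    (hG.comp_measurePreserving (measurePreserving_nsmul_add μ _)).const_mul _

/-- The sampling algorithm that realises the lattice rule with generator `z` and shift `x`. -/
def latticeAlgorithm {d : ℕ} (K m : ℕ) (z x : UnitAddTorus (Fin d)) : SamplingAlgorithm d where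
  node l := torusRep (l.length • z + x)
  output l := ∑ t : Fin K → Fin m, (m : ℂ)⁻¹ ^ K * l.getD (∑ k, (t k : ℕ)) 0

theorem samples_latticeAlgorithm {d : ℕ} (K m : ℕ) (z x : UnitAddTorus (Fin d)) (f : Cube d → ℂ)
    (n : ℕ) : (latticeAlgorithm K m z x).samples f n =
      (List.range n).map fun i => f (torusRep (i • z + x)) := by
  induction n with
  | zero => rfl
  | succ n ih =>
    rw [SamplingAlgorithm.samples, ih, List.range_succ, List.map_append]
    simp [latticeAlgorithm]

theorem result_latticeAlgorithm {d K m : ℕ} (hK : 0 < K) (z x : UnitAddTorus (Fin d))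
    (f : Cube d → ℂ) : (latticeAlgorithm K m z x).result (K * m) f =
      latticeRule K m (f ∘ torusRep) z x := by
  rw [SamplingAlgorithm.result, samples_latticeAlgorithm]
  simp only [latticeAlgorithm, latticeRule]
  refine Finset.sum_congr rfl fun t _ => ?_
  -- Every index occurs among the `K * m` samples, so the default value `0` of `getD` is never used.
  have : ∑ k, (t k : ℕ) < K * m := by
    have : Nonempty (Fin K) := ⟨⟨0, hK⟩⟩
    calc ∑ k, (t k : ℕ) < ∑ _k : Fin K, m :=
          Finset.sum_lt_sum_of_nonempty Finset.univ_nonempty fun k _ => (t k).2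
      _ = K * m := by simp
  simp [List.getD, this]

/-- The randomized lattice algorithm whose generator is uniformly distributed on the set `S` and
whose shift is uniformly distributed on the torus. -/
def randomLattice {d K m : ℕ} (hK : 0 < K) (S : Set (UnitAddTorus (Fin d)))
    (hS : torusMeasure d S ≠ 0) (α : ℝ) (γ : ℕ → ℝ) :
    RandomizedAlgorithm d (K * m) (sobolevSpace d α γ) where
  Ω := UnitAddTorus (Fin d) × UnitAddTorus (Fin d)
  measurableSpace := inferInstance
  P := (ProbabilityTheory.cond (torusMeasure d) S).prod (torusMeasure d)
  isProbabilityMeasure :=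
    have := ProbabilityTheory.cond_isProbabilityMeasure hS
    inferInstance
  algorithm p := latticeAlgorithm K m p.1 p.2
  aemeasurable_result f hf := by
    have := ProbabilityTheory.cond_isProbabilityMeasure hS
    simp only [result_latticeAlgorithm hK]
    exact (aestronglyMeasurable_latticeRule K m
      (hf.1.comp_measurePreserving (measurePreserving_torusRep d)).1 _).aemeasurable

theorem tsum_le_one_of_sobolevNorm_le_one {d : ℕ} {α : ℝ} {γ : ℕ → ℝ} {f : Cube d → ℂ}
    (hf : sobolevNorm α γ f ≤ 1) :
    ∑' h : Fin d → ℤ, (ENNReal.ofReal (weight α γ h) * ‖fourierCoefficient f h‖ₑ) ^ 2 ≤ 1 := by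
  unfold sobolevNorm at hf
  by_contra! hlt
  exact absurd hf (not_le.2 (ENNReal.one_lt_rpow hlt (by norm_num)))

/-- Of the `K` factors `|avgChar|²`, `K - 1` are bounded pointwise on `S` by `hB`. The last is
averaged: conditioning on `S` costs at most a factor `2`, so its mean is at most `2 / m`.
Cauchy–Schwarz passes from the mean square to the mean error. -/
theorem randomizedError_randomLattice_le {d K m : ℕ} (hK : 0 < K) (hm : 0 < m)
    {S : Set (UnitAddTorus (Fin d))} (hSm : MeasurableSet S) (hS : torusMeasure d S ≠ 0)
    (hS2 : (1 / 2 : ℝ≥0∞) ≤ torusMeasure d S) {α : ℝ} {γ : ℕ → ℝ} {B : ℝ≥0∞}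
    (hB : ∀ z ∈ S, ∀ h : Fin d → ℤ, h ≠ 0 →
      ‖avgChar m h z‖ₑ ^ (2 * (K - 1)) ≤ B * ENNReal.ofReal (weight α γ h) ^ 2) :
    randomizedError α γ (randomLattice (m := m) hK S hS α γ) ≤
      (2 * B * (m : ℝ≥0∞)⁻¹) ^ (1 / 2 : ℝ) := by
  refine iSup₂_le fun f hf => ?_
  obtain ⟨hfs, hf1⟩ := hf
  have hG := hfs.1.comp_measurePreserving (measurePreserving_torusRep d)
  have hP := ProbabilityTheory.cond_isProbabilityMeasure hS
  set μ := ProbabilityTheory.cond (torusMeasure d) S with hμ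
  set G := f ∘ torusRep with hGdef
  change ∫⁻ p, ‖(latticeAlgorithm K m p.1 p.2).result (K * m) f - cubeIntegral f‖ₑ
    ∂(μ.prod (torusMeasure d)) ≤ _
  simp only [result_latticeAlgorithm hK, cubeIntegral_eq_fourierCoefficient,
    ← torusCoeff_comp_torusRep hfs.1.1, ← hGdef]
  have hmeas := (aestronglyMeasurable_latticeRule K m hG.1 μ).sub
    (aestronglyMeasurable_const (b := torusCoeff G 0))
  have hL2 : ∫⁻ p, ‖latticeRule K m G p.1 p.2 - torusCoeff G 0‖ₑ ^ 2
      ∂(μ.prod (torusMeasure d)) ≤ 2 * B * (m : ℝ≥0∞)⁻¹ := by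
    calc _ ≤ ∫⁻ z, ∫⁻ x, ‖latticeRule K m G z x - torusCoeff G 0‖ₑ ^ 2 ∂torusMeasure d ∂μ :=
          lintegral_prod_le _
      _ = ∑' h : Fin d → ℤ, ∫⁻ z, (if h = 0 then 0 else
            (‖avgChar m h z‖ₑ ^ K * ‖torusCoeff G h‖ₑ) ^ 2) ∂μ := by
          simp only [lintegral_enorm_sq_latticeRule_sub hm hG]
          refine lintegral_tsum fun h => ?_
          split_ifs
          · exact aemeasurable_const
          · exact ((((continuous_avgChar m h).measurable.enorm.pow_const K).mul_const _).pow_const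
              2).aemeasurable
      _ ≤ ∑' h : Fin d → ℤ, 2 * B * (m : ℝ≥0∞)⁻¹ *
            (ENNReal.ofReal (weight α γ h) * ‖fourierCoefficient f h‖ₑ) ^ 2 := by
          refine ENNReal.tsum_le_tsum fun h => ?_
          split_ifs with h0
          · simp
          rw [hμ, ProbabilityTheory.cond, lintegral_smul_measure, smul_eq_mul]
          calc _ ≤ 2 * ∫⁻ z in S, B * ENNReal.ofReal (weight α γ h) ^ 2 *
                  ‖torusCoeff G h‖ₑ ^ 2 * ‖avgChar m h z‖ₑ ^ 2 ∂torusMeasure d := by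
                refine mul_le_mul' ?_ (setLIntegral_mono' hSm fun z hz => ?_)
                · rw [ENNReal.inv_le_iff_inv_le]; simpa using hS2
                · have := hB z hz h h0
                  calc (‖avgChar m h z‖ₑ ^ K * ‖torusCoeff G h‖ₑ) ^ 2
                      = ‖avgChar m h z‖ₑ ^ (2 * (K - 1)) * ‖torusCoeff G h‖ₑ ^ 2 *
                        ‖avgChar m h z‖ₑ ^ 2 := by
                        obtain ⟨k, rfl⟩ : ∃ k, K = k + 1 := ⟨K - 1, by omega⟩
                        rw [Nat.add_sub_cancel]; ring
                    _ ≤ _ := by gcongr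
            _ ≤ 2 * (B * ENNReal.ofReal (weight α γ h) ^ 2 *
                  ‖torusCoeff G h‖ₑ ^ 2 * (m : ℝ≥0∞)⁻¹) := by
                gcongr
                rw [lintegral_const_mul _
                  ((continuous_avgChar m h).measurable.enorm.pow_const 2)]
                gcongr
                exact (setLIntegral_le_lintegral _ _).trans
                  (lintegral_enorm_sq_avgChar hm h0).le
            _ = _ := by
                rw [hGdef, torusCoeff_comp_torusRep hfs.1.1]; ring
      _ ≤ 2 * B * (m : ℝ≥0∞)⁻¹ := by
          rw [ENNReal.tsum_mul_left]
          exact mul_le_of_le_one_right' (tsum_le_one_of_sobolevNorm_le_one hf1)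
  have := eLpNorm_le_eLpNorm_of_exponent_le (p := 1) (q := 2) (by norm_num) hmeas
  rw [eLpNorm_one_eq_lintegral_enorm, eLpNorm_eq_lintegral_rpow_enorm_toReal (by norm_num)
    (by norm_num)] at this
  refine this.trans ?_
  simp only [ENNReal.toReal_ofNat, ENNReal.rpow_ofNat]
  gcongr
  exact hL2

/-! ### Summability of the inverse weights and good generators -/

theorem one_le_weight₁ (α γ : ℝ) (k : ℤ) : 1 ≤ weight₁ α γ k := by
  unfold weight₁
  split_ifs
  · exact le_rfl
  · exact le_max_left _ _

theorem one_le_weight {d : ℕ} (α : ℝ) (γ : ℕ → ℝ) (h : Fin d → ℤ) : 1 ≤ weight α γ h :=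
  Finset.prod_induction _ (fun x : ℝ => 1 ≤ x) (fun _ _ => one_le_mul_of_one_le_of_one_le) le_rfl
    fun _ _ => one_le_weight₁ _ _ _

theorem tsum_prod_eq_prod_tsum {d : ℕ} (w : Fin d → ℤ → ℝ≥0∞) :
    ∑' h : Fin d → ℤ, ∏ j, w j (h j) = ∏ j, ∑' k, w j k := by
  induction d with
  | zero => simp
  | succ d ih =>
    rw [← (Fin.consEquiv fun _ => ℤ).tsum_eq, ENNReal.tsum_prod', Fin.prod_univ_succ, ← ih,
      ← ENNReal.tsum_mul_right]
    refine tsum_congr fun k => ?_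
    rw [← ENNReal.tsum_mul_left]
    refine tsum_congr fun g => ?_
    simp [Fin.prod_univ_succ, Fin.consEquiv]

theorem weight₁_rpow_le {α γ l : ℝ} (hγ : 0 < γ) (hl : 0 < l) {k : ℤ} (hk : k ≠ 0) :
    weight₁ α γ k ^ (-(1 / l)) ≤ γ ^ (1 / l) * |(k : ℝ)| ^ (-(α / l)) := by
  have hk' : 0 < |(k : ℝ)| := by positivity
  calc weight₁ α γ k ^ (-(1 / l)) ≤ (|(k : ℝ)| ^ α / γ) ^ (-(1 / l)) := by
        refine Real.rpow_le_rpow_of_nonpos (by positivity) ?_ (by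
          rw [Left.neg_nonpos_iff]; positivity)
        rw [weight₁, if_neg hk]
        exact le_max_right _ _
    _ = γ ^ (1 / l) * |(k : ℝ)| ^ (-(α / l)) := by
        rw [Real.div_rpow (by positivity) hγ.le, ← Real.rpow_mul hk'.le, Real.rpow_neg hγ.le,
          div_inv_eq_mul, mul_comm]
        congr 2
        ring

/-- The sum factorises over coordinates into factors at most `1 + γ_j^(1/l) Z`, where `Z = ∑
|k|^(-α/l)` is finite because `l < α`. Since `1 + x ≤ exp x`, the product is at most `exp (Z ∑
γ_j^(1/l))`, whatever `d` is. -/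
theorem exists_tsum_weight_rpow_le {α l : ℝ} {γ : ℕ → ℝ} (hγ : ∀ j, 0 < γ j) (hl : 0 < l)
    (hlα : l < α) (hs : Summable fun j => γ j ^ (1 / l)) :
    ∃ A : ℝ≥0, 0 < A ∧ ∀ d : ℕ,
      ∑' h : Fin d → ℤ, ENNReal.ofReal (weight α γ h ^ (-(1 / l))) ≤ A := by
  have hZ : Summable fun k : ℤ => |(k : ℝ)| ^ (-(α / l)) :=
    Real.summable_abs_int_rpow ((one_lt_div hl).2 hlα)
  set Z := ∑' k : ℤ, |(k : ℝ)| ^ (-(α / l)) with hZdef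
  have hZ0 : 0 ≤ Z := tsum_nonneg fun _ => by positivity
  have h1 : ∀ j, ∑' k : ℤ, ENNReal.ofReal (weight₁ α (γ j) k ^ (-(1 / l))) ≤
      ENNReal.ofReal (1 + γ j ^ (1 / l) * Z) := fun j => by
    have hg : 0 ≤ γ j ^ (1 / l) := Real.rpow_nonneg (hγ j).le _
    calc _ ≤ ∑' k : ℤ, ((if k = 0 then 1 else 0) +
          ENNReal.ofReal (γ j ^ (1 / l) * |(k : ℝ)| ^ (-(α / l)))) := by
          refine ENNReal.tsum_le_tsum fun k => ?_
          by_cases hk : k = 0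
          · subst hk
            simp [weight₁]
          · rw [if_neg hk, zero_add]
            exact ENNReal.ofReal_le_ofReal (weight₁_rpow_le (hγ j) hl hk)
      _ = _ := by
          rw [ENNReal.tsum_add, tsum_ite_eq, ← ENNReal.ofReal_tsum_of_nonneg
            (fun _ => by positivity) (hZ.mul_left _), tsum_mul_left,
            ENNReal.ofReal_add zero_le_one (by positivity), ENNReal.ofReal_one]
  refine ⟨(Real.exp ((∑' j, γ j ^ (1 / l)) * Z)).toNNReal,
    Real.toNNReal_pos.2 (Real.exp_pos _), fun d => ?_⟩
  calc _ = ∑' h : Fin d → ℤ, ∏ j : Fin d, ENNReal.ofReal (weight₁ α (γ j) (h j) ^ (-(1 / l))) := by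
        refine tsum_congr fun h => ?_
        have : ∀ j : Fin d, 0 ≤ weight₁ α (γ j) (h j) := fun j =>
          zero_le_one.trans (one_le_weight₁ _ _ _)
        rw [weight, ← Real.finsetProd_rpow _ _ fun j _ => this j,
          ENNReal.ofReal_prod_of_nonneg fun j _ => Real.rpow_nonneg (this j) _]
    _ ≤ ∏ j : Fin d, ENNReal.ofReal (1 + γ j ^ (1 / l) * Z) := by
        rw [tsum_prod_eq_prod_tsum fun (j : Fin d) k =>
          ENNReal.ofReal (weight₁ α (γ j) k ^ (-(1 / l)))]
        exact Finset.prod_le_prod' fun j _ => h1 j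
    _ ≤ ENNReal.ofReal (Real.exp ((∑' j, γ j ^ (1 / l)) * Z)) := by
        have hg : ∀ j, 0 ≤ γ j ^ (1 / l) := fun j => Real.rpow_nonneg (hγ j).le _
        rw [← ENNReal.ofReal_prod_of_nonneg fun (j : Fin d) _ =>
          add_nonneg zero_le_one (mul_nonneg (hg j) hZ0)]
        refine ENNReal.ofReal_le_ofReal ?_
        calc _ ≤ ∏ j : Fin d, Real.exp (γ j ^ (1 / l) * Z) := by
              refine Finset.prod_le_prod (fun j _ => add_nonneg zero_le_one
                (mul_nonneg (hg j) hZ0)) fun j _ => ?_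
              rw [add_comm]; exact Real.add_one_le_exp _
          _ = Real.exp ((∑ j ∈ Finset.range d, γ j ^ (1 / l)) * Z) := by
              rw [← Real.exp_sum, ← Finset.sum_mul,
                Fin.sum_univ_eq_sum_range (fun j => γ j ^ (1 / l))]
          _ ≤ _ := by
              gcongr
              exact hs.sum_le_tsum _ fun j _ => hg j
    _ = _ := rfl

/-- The generators whose character averages are small at all nonzero frequencies, relative to the
weights. -/
def goodGenerators (d m : ℕ) (α l : ℝ) (γ : ℕ → ℝ) (A : ℝ≥0) : Set (UnitAddTorus (Fin d)) :=
  {z | ∀ h : Fin d → ℤ, h ≠ 0 →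
    ‖avgChar m h z‖ₑ ^ 2 ≤ 2 * A * ENNReal.ofReal (weight α γ h ^ (1 / l)) * (m : ℝ≥0∞)⁻¹}

theorem measurableSet_goodGenerators (d m : ℕ) (α l : ℝ) (γ : ℕ → ℝ) (A : ℝ≥0) :
    MeasurableSet (goodGenerators d m α l γ A) := by
  unfold goodGenerators
  simp only [Set.ofPred_forall]
  exact MeasurableSet.iInter fun h => MeasurableSet.iInter fun _ =>
    measurableSet_le ((continuous_avgChar m h).measurable.enorm.pow_const 2) measurable_const

/-- By Markov, frequency `h` fails with probability at most `r(h)^(-1/l) / (2A)`, and these sum to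
at most `1/2`. -/
theorem half_le_measure_goodGenerators {d m : ℕ} (hm : 0 < m) {α l : ℝ} {γ : ℕ → ℝ} {A : ℝ≥0}
    (hA : 0 < A)
    (hsum : ∑' h : Fin d → ℤ, ENNReal.ofReal (weight α γ h ^ (-(1 / l))) ≤ A) :
    (1 / 2 : ℝ≥0∞) ≤ torusMeasure d (goodGenerators d m α l γ A) := by
  have hA' : (A : ℝ≥0∞) ≠ 0 := by exact_mod_cast hA.ne'
  have hm' : (m : ℝ≥0∞) ≠ 0 := by exact_mod_cast hm.ne'
  have hc : torusMeasure d (goodGenerators d m α l γ A)ᶜ ≤ 1 / 2 := by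
    calc _ ≤ torusMeasure d (⋃ h : Fin d → ℤ, {z | h ≠ 0 ∧
            2 * A * ENNReal.ofReal (weight α γ h ^ (1 / l)) * (m : ℝ≥0∞)⁻¹ ≤
              ‖avgChar m h z‖ₑ ^ 2}) := by
          refine measure_mono fun z hz => ?_
          simp only [goodGenerators, Set.mem_compl_iff, Set.mem_ofPred_eq, not_forall,
            not_le] at hz
          obtain ⟨h, h0, hz⟩ := hz
          exact Set.mem_iUnion.2 ⟨h, h0, hz.le⟩
      _ ≤ ∑' h : Fin d → ℤ, torusMeasure d {z | h ≠ 0 ∧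
            2 * A * ENNReal.ofReal (weight α γ h ^ (1 / l)) * (m : ℝ≥0∞)⁻¹ ≤
              ‖avgChar m h z‖ₑ ^ 2} := measure_iUnion_le _
      _ ≤ ∑' h : Fin d → ℤ, (2 * A : ℝ≥0∞)⁻¹ * ENNReal.ofReal (weight α γ h ^ (-(1 / l))) := by
          refine ENNReal.tsum_le_tsum fun h => ?_
          by_cases h0 : h = 0
          · simp [h0]
          have hr : 0 < weight α γ h := zero_lt_one.trans_le (one_le_weight α γ h)
          have hr' : ENNReal.ofReal (weight α γ h ^ (1 / l)) ≠ 0 := by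
            rw [Ne, ENNReal.ofReal_eq_zero, not_le]; positivity
          simp only [ne_eq, h0, not_false_eq_true, true_and]
          have hX0 : 2 * (A : ℝ≥0∞) * ENNReal.ofReal (weight α γ h ^ (1 / l)) ≠ 0 :=
            mul_ne_zero (mul_ne_zero two_ne_zero hA') hr'
          have hXt : 2 * (A : ℝ≥0∞) * ENNReal.ofReal (weight α γ h ^ (1 / l)) ≠ ∞ :=
            ENNReal.mul_ne_top (ENNReal.mul_ne_top (by simp) (by simp)) (by simp)
          refine (meas_ge_le_lintegral_div
            ((continuous_avgChar m h).measurable.enorm.pow_const 2).aemeasurable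
            (mul_ne_zero hX0 (by simp)) (ENNReal.mul_ne_top hXt (by simpa using hm.ne'))).trans ?_
          rw [lintegral_enorm_sq_avgChar hm h0, ENNReal.div_eq_inv_mul,
            ENNReal.mul_inv (.inl hX0) (.inl hXt), mul_assoc,
            ENNReal.inv_mul_cancel (by simp) (by simpa using hm.ne'), mul_one,
            ENNReal.mul_inv (.inr (by simp)) (.inr hr'), Real.rpow_neg hr.le,
            ENNReal.ofReal_inv_of_pos (by positivity)]
      _ ≤ (2 * A : ℝ≥0∞)⁻¹ * A := by
          rw [ENNReal.tsum_mul_left]; gcongr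
      _ = 1 / 2 := by
          rw [ENNReal.mul_inv (by simp) (by simp), mul_assoc,
            ENNReal.inv_mul_cancel hA' (by simp)]
          simp
  have h2 := prob_compl_eq_one_sub (μ := torusMeasure d)
    (measurableSet_goodGenerators d m α l γ A)
  rw [h2, tsub_le_iff_left] at hc
  have h3 : (1 / 2 : ℝ≥0∞) + 1 / 2 = 1 := ENNReal.add_halves 1
  have h4 : (1 / 2 : ℝ≥0∞) + 1 / 2 ≤ torusMeasure d (goodGenerators d m α l γ A) + 1 / 2 := by
    rwa [h3]
  exact (ENNReal.add_le_add_iff_right (by simp)).1 h4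

theorem enorm_avgChar_pow_le {d m : ℕ} {α l : ℝ} (hl : 0 < l) {γ : ℕ → ℝ}
    {A : ℝ≥0} {K : ℕ} (hK : 2 * l ≤ K) {z : UnitAddTorus (Fin d)}
    (hz : z ∈ goodGenerators d m α l γ A) {h : Fin d → ℤ} (hh : h ≠ 0) :
    ‖avgChar m h z‖ₑ ^ (2 * K) ≤
      ((2 * A : ℝ≥0∞) ^ (2 * l) * (m : ℝ≥0∞)⁻¹ ^ (2 * l)) * ENNReal.ofReal (weight α γ h) ^ 2 := by
  have hr : 0 < weight α γ h := zero_lt_one.trans_le (one_le_weight α γ h)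
  have h1 : ‖avgChar m h z‖ₑ ≤ 1 := by
    rw [← ofReal_norm]
    exact ENNReal.ofReal_le_one.2 (norm_avgChar_le_one h z)
  -- Since `|avgChar| ≤ 1`, the exponent `K` may be lowered to `2 * l`, which turns `r(h)^(1/l)`
  -- into exactly `r(h)^2`.
  calc ‖avgChar m h z‖ₑ ^ (2 * K) = (‖avgChar m h z‖ₑ ^ 2) ^ (K : ℝ) := by
        rw [ENNReal.rpow_natCast, pow_mul]
    _ ≤ (‖avgChar m h z‖ₑ ^ 2) ^ (2 * l) :=
        ENNReal.rpow_le_rpow_of_exponent_ge (pow_le_one' h1 2) hK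
    _ ≤ (2 * A * ENNReal.ofReal (weight α γ h ^ (1 / l)) * (m : ℝ≥0∞)⁻¹) ^ (2 * l) :=
        ENNReal.rpow_le_rpow (hz h hh) (by positivity)
    _ = _ := by
        rw [ENNReal.mul_rpow_of_nonneg _ _ (by positivity),
          ENNReal.mul_rpow_of_nonneg _ _ (by positivity),
          ENNReal.ofReal_rpow_of_pos (by positivity), ← Real.rpow_mul hr.le,
          show 1 / l * (2 * l) = (2 : ℕ) by field_simp; norm_num, Real.rpow_natCast,
          ENNReal.ofReal_pow hr.le]
        ring

/-! ### From error rates to the upper bound for the exponent -/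

/-- Randomized algorithms of order `s` with constants independent of the dimension bound the
complexity. -/
theorem complexityBound_of_error_le {α : ℝ} {γ : ℕ → ℝ} {s M : ℝ} (hs : 0 < s) (hM : 0 < M)
    {K : ℕ} (hK : 0 < K)
    (H : ∀ d m : ℕ, 0 < m → ∃ A : RandomizedAlgorithm d (K * m) (sobolevSpace d α γ),
      randomizedError α γ A ≤ ENNReal.ofReal (M * (m : ℝ) ^ (-s)))
    {p : ℝ≥0} (hp : (p : ℝ) = 1 / s) : ComplexityBound α γ p := by
  refine ⟨K * (M ^ (1 / s) + 1), by positivity, fun d _ ε hε hε1 => ?_⟩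
  set m := ⌈(M / ε) ^ (1 / s)⌉₊ with hmdef
  have hpos : 0 < (M / ε) ^ (1 / s) := by positivity
  have hm : 0 < m := Nat.ceil_pos.2 hpos
  obtain ⟨A, hA⟩ := H d m hm
  have herr : M * (m : ℝ) ^ (-s) ≤ ε := by
    have h1 : (M / ε) ^ (1 / s) ≤ m := Nat.le_ceil _
    have h2 := Real.rpow_le_rpow_of_nonpos hpos h1 (neg_nonpos.2 hs.le)
    rw [← Real.rpow_mul (by positivity), show 1 / s * -s = -1 by field_simp,
      Real.rpow_neg_one, inv_div] at h2
    calc M * (m : ℝ) ^ (-s) ≤ M * (ε / M) := by gcongr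
      _ = ε := by field_simp
  have hn : informationComplexity α γ ε d ≤ ((K * m : ℕ) : ℕ∞) :=
    iInf₂_le (K * m) ⟨A, hA.trans (ENNReal.ofReal_le_ofReal herr)⟩
  refine (ENat.toENNReal_le.2 hn).trans ?_
  rw [ENat.toENNReal_coe, ← ENNReal.ofReal_natCast]
  refine ENNReal.ofReal_le_ofReal ?_
  have h3 : (m : ℝ) ≤ (M / ε) ^ (1 / s) + 1 := (Nat.ceil_lt_add_one hpos.le).le
  have h4 : (M / ε) ^ (1 / s) = M ^ (1 / s) * ε ^ (-(1 / s)) := by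
    rw [Real.div_rpow hM.le hε.le, Real.rpow_neg hε.le, div_eq_mul_inv]
  -- This absorbs the `+ 1` from rounding `m` up into the power of `ε`.
  have h5 : 1 ≤ ε ^ (-(1 / s)) :=
    Real.one_le_rpow_of_pos_of_le_one_of_nonpos hε hε1.le (by
      rw [Left.neg_nonpos_iff]; positivity)
  rw [hp]
  push_cast
  calc (K : ℝ) * m ≤ K * (M ^ (1 / s) * ε ^ (-(1 / s)) + ε ^ (-(1 / s))) := by
        gcongr; linarith
    _ = _ := by ring

/-- The Monte Carlo rate: with `K = 1` no pointwise factor remains, so every generator is admissible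
and `B = 1` works because the weights are at least `1`. -/
theorem complexityBound_two (α : ℝ) (γ : ℕ → ℝ) : ComplexityBound α γ 2 := by
  refine complexityBound_of_error_le (s := 1 / 2) (M := 2 ^ (1 / 2 : ℝ)) (K := 1) (by norm_num)
    (by positivity) one_pos (fun d m hm => ?_) (by norm_num)
  have hS : torusMeasure d Set.univ ≠ 0 := by simp
  refine ⟨randomLattice one_pos Set.univ hS α γ,
    (randomizedError_randomLattice_le one_pos hm MeasurableSet.univ hS (by simp) (B := 1)
      fun z _ h _ => ?_).trans_eq ?_⟩
  · have := ENNReal.ofReal_le_ofReal (one_le_weight α γ h)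
    rw [ENNReal.ofReal_one] at this
    simpa using one_le_pow₀ this
  · have hm' : (0 : ℝ) < m := by exact_mod_cast hm
    rw [mul_one, show (2 : ℝ≥0∞) * (m : ℝ≥0∞)⁻¹ = ENNReal.ofReal (2 * (m : ℝ)⁻¹) by
      rw [ENNReal.ofReal_mul zero_le_two, ENNReal.ofReal_inv_of_pos hm']; simp,
      ENNReal.ofReal_rpow_of_pos (by positivity), Real.mul_rpow zero_le_two (by positivity),
      Real.inv_rpow hm'.le, Real.rpow_neg hm'.le]

theorem complexityBound_of_summable {α l : ℝ} {γ : ℕ → ℝ} (hγ : ∀ j, 0 < γ j) (hl : 0 < l)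
    (hlα : l < α) (hs : Summable fun j => γ j ^ (1 / l)) {p : ℝ≥0}
    (hp : (p : ℝ) = 1 / (l + 1 / 2)) : ComplexityBound α γ p := by
  obtain ⟨A, hA, hsum⟩ := exists_tsum_weight_rpow_le hγ hl hlα hs
  have hA' : (0 : ℝ) < A := hA
  refine complexityBound_of_error_le (s := l + 1 / 2) (M := (2 * (2 * A) ^ (2 * l)) ^ (1 / 2 : ℝ))
    -- One factor is reserved for averaging over the generator; the other `⌈2 * l⌉₊` carry the
    -- smoothness.
    (K := ⌈2 * l⌉₊ + 1) (by positivity) (by positivity) (Nat.succ_pos _) (fun d m hm => ?_) hp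
  have h2 := half_le_measure_goodGenerators (m := m) hm hA (hsum d)
  have hS : torusMeasure d (goodGenerators d m α l γ A) ≠ 0 := fun h0 => by simp [h0] at h2
  refine ⟨randomLattice (Nat.succ_pos _) _ hS α γ,
    (randomizedError_randomLattice_le (Nat.succ_pos _) hm
      (measurableSet_goodGenerators d m α l γ A) hS h2
      (B := (2 * A : ℝ≥0∞) ^ (2 * l) * (m : ℝ≥0∞)⁻¹ ^ (2 * l)) fun z hz h hh => ?_).trans_eq ?_⟩
  · exact enorm_avgChar_pow_le hl (Nat.le_ceil _) hz hh
  · have hm' : (0 : ℝ) < m := by exact_mod_cast hm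
    have e1 : (2 * A : ℝ≥0∞) = ENNReal.ofReal (2 * A) := by
      rw [ENNReal.ofReal_mul zero_le_two]; simp
    have e2 : (m : ℝ≥0∞)⁻¹ = ENNReal.ofReal (m : ℝ)⁻¹ := by
      rw [ENNReal.ofReal_inv_of_pos hm']; simp
    have e3 : (2 : ℝ≥0∞) = ENNReal.ofReal 2 := by simp
    have hx : 0 < (m : ℝ)⁻¹ := by positivity
    rw [e1, e2, ENNReal.ofReal_rpow_of_pos (by positivity), ENNReal.ofReal_rpow_of_pos hx,
      e3, ← ENNReal.ofReal_mul (by positivity), ← ENNReal.ofReal_mul (by positivity),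
      ← ENNReal.ofReal_mul (by positivity), ENNReal.ofReal_rpow_of_pos (by positivity)]
    congr 1
    rw [← mul_assoc, mul_assoc _ _ (m : ℝ)⁻¹, Real.mul_rpow (by positivity) (by positivity),
      ← Real.rpow_add_one hx.ne', ← Real.rpow_mul hx.le, Real.inv_rpow hm'.le,
      ← Real.rpow_neg hm'.le]
    congr 2
    ring

theorem strongTractabilityExponent_le {α : ℝ} {γ : ℕ → ℝ} (hγ : ∀ j, 0 < γ j)
    (hγ1 : ∀ j, γ j ≤ 1) :
    strongTractabilityExponent α γ ≤
      max (1 / (summabilityIndex γ + 1 / 2)) (1 / (ENNReal.ofReal α + 1 / 2)) := by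
  have hanti : Antitone fun x : ℝ≥0∞ => 1 / (x + 1 / 2) := fun x y h => by
    simp only [one_div]; gcongr
  rw [← hanti.map_min]
  set E := strongTractabilityExponent α γ with hE
  have key : ∀ x : ℝ≥0, (x : ℝ≥0∞) < min (summabilityIndex γ) (ENNReal.ofReal α) →
      (x : ℝ≥0∞) + 1 / 2 ≤ E⁻¹ := fun x hx => by
    obtain ⟨hx1, hx2⟩ := lt_min_iff.1 hx
    rw [ENNReal.le_inv_iff_le_inv]
    have hbound : ComplexityBound α γ (x + 1 / 2)⁻¹ := by
      rcases eq_or_lt_of_le x.2 with h0 | h0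
      · obtain rfl : x = 0 := NNReal.eq h0.symm
        simpa using complexityBound_two α γ
      · have hx2' : (x : ℝ) < α := by
          rw [← ENNReal.ofReal_coe_nnreal] at hx2
          exact (ENNReal.ofReal_lt_ofReal_iff_of_nonneg x.2).1 hx2
        simp only [summabilityIndex, lt_iSup_iff] at hx1
        obtain ⟨l, ⟨hl, hs⟩, hxl⟩ := hx1
        rw [← ENNReal.ofReal_coe_nnreal] at hxl
        have hxl' : (x : ℝ) < l := (ENNReal.ofReal_lt_ofReal_iff_of_nonneg x.2).1 hxl
        have h0' : (0 : ℝ) < x := h0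
        -- As `γ j ≤ 1`, summability for `l` passes to every smaller positive index, here `x`.
        refine complexityBound_of_summable hγ h0' hx2' (hs.of_nonneg_of_le
          (fun j => Real.rpow_nonneg (hγ j).le _) fun j =>
          Real.rpow_le_rpow_of_exponent_ge (hγ j) (hγ1 j)
            (one_div_le_one_div_of_le h0' hxl'.le)) ?_
        simp
    refine (iInf₂_le _ hbound).trans_eq ?_
    rw [ENNReal.coe_inv (by positivity), ENNReal.coe_add, ENNReal.coe_div two_ne_zero]
    rfl
  -- Needed because subtraction in `ℝ≥0∞` is truncated; it also covers a minimum equal to `0`, where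
  -- `key` is vacuous.
  have hhalf : (1 / 2 : ℝ≥0∞) ≤ E⁻¹ := by
    rw [ENNReal.le_inv_iff_le_inv]
    refine (iInf₂_le _ (complexityBound_two α γ)).trans_eq ?_
    simp
  have hsub : min (summabilityIndex γ) (ENNReal.ofReal α) ≤ E⁻¹ - 1 / 2 := by
    refine le_of_forall_lt_imp_le_of_dense fun x hx => ?_
    lift x to ℝ≥0 using hx.ne_top
    exact ENNReal.le_sub_of_add_le_right (by simp) (key x hx)
  rw [one_div, ← ENNReal.le_inv_iff_le_inv]
  calc _ ≤ E⁻¹ - 1 / 2 + 1 / 2 := by gcongr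
    _ = E⁻¹ := tsub_add_cancel_of_le hhalf

/-! ### Moments of random signs under adaptive selection -/

/-- The sign `1` or `-1` encoded by a Boolean. -/
def boolSign (b : Bool) : ℝ := if b then 1 else -1

theorem boolSign_not (b : Bool) : boolSign (!b) = -boolSign b := by cases b <;> simp [boolSign]

theorem boolSign_sq (b : Bool) : boolSign b ^ 2 = 1 := by cases b <;> simp [boolSign]

theorem abs_boolSign (b : Bool) : |boolSign b| = 1 := by cases b <;> simp [boolSign]

section SelectedSigns

variable {N : ℕ} (u : (Fin N → Bool) → Finset (Fin N))

/-- `u σ` depends only on the signs outside of `u σ`. -/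
def DependsOnComplement : Prop :=
  ∀ σ σ' : Fin N → Bool, (∀ i ∉ u σ, σ' i = σ i) → u σ' = u σ

/-- The `i`-th sign if `i` is selected, and `0` otherwise. -/
def selectedSign (σ : Fin N → Bool) (i : Fin N) : ℝ := if i ∈ u σ then boolSign (σ i) else 0

/-- Flip those signs in `s` that are selected. -/
def flipSelected (s : Finset (Fin N)) (σ : Fin N → Bool) : Fin N → Bool :=
  fun i => if i ∈ s ∧ i ∈ u σ then !σ i else σ i

variable {u}

theorem DependsOnComplement.apply_flipSelected (hu : DependsOnComplement u) (s : Finset (Fin N))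
    (σ : Fin N → Bool) : u (flipSelected u s σ) = u σ :=
  hu _ _ fun i hi => by simp [flipSelected, hi]

theorem DependsOnComplement.involutive_flipSelected (hu : DependsOnComplement u)
    (s : Finset (Fin N)) : Function.Involutive (flipSelected u s) := fun σ => by
  funext i
  have := hu.apply_flipSelected s σ
  change (if i ∈ s ∧ i ∈ u (flipSelected u s σ) then !flipSelected u s σ i
    else flipSelected u s σ i) = σ i
  rw [this]
  by_cases h : i ∈ s ∧ i ∈ u σ <;> simp [flipSelected, h]

theorem DependsOnComplement.selectedSign_flipSelected (hu : DependsOnComplement u)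
    (s : Finset (Fin N)) (σ : Fin N → Bool) (i : Fin N) :
    selectedSign u (flipSelected u s σ) i =
      if i ∈ s then -selectedSign u σ i else selectedSign u σ i := by
  unfold selectedSign
  rw [hu.apply_flipSelected]
  by_cases hs : i ∈ s <;> by_cases hi : i ∈ u σ <;> simp [flipSelected, hs, hi, boolSign_not]

theorem DependsOnComplement.sum_comp_flipSelected (hu : DependsOnComplement u)
    (s : Finset (Fin N)) (g : (Fin N → Bool) → ℝ) : ∑ σ, g (flipSelected u s σ) = ∑ σ, g σ :=
  Equiv.sum_comp (hu.involutive_flipSelected s).toPerm g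

/-- Flipping the `i`-th sign when it is selected preserves the selection and the sum over `s`, but
negates the last factor. Thus mixed odd moments vanish as for independent signs, although the
selection depends on `σ`. -/
theorem DependsOnComplement.sum_mul_selectedSign (hu : DependsOnComplement u) {i : Fin N}
    {s : Finset (Fin N)} (hi : i ∉ s) (P : ℝ → ℝ) :
    ∑ σ, P (∑ j ∈ s, selectedSign u σ j) * selectedSign u σ i = 0 := by
  have h := hu.sum_comp_flipSelected {i}
    fun σ => P (∑ j ∈ s, selectedSign u σ j) * selectedSign u σ i
  have hs : ∀ σ, ∑ j ∈ s, selectedSign u (flipSelected u {i} σ) j =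
      ∑ j ∈ s, selectedSign u σ j := fun σ => Finset.sum_congr rfl fun j hj => by
    rw [hu.selectedSign_flipSelected, if_neg]
    rw [Finset.mem_singleton]
    rintro rfl
    exact hi hj
  simp only [hs] at h
  simp only [hu.selectedSign_flipSelected, Finset.mem_singleton, if_true, mul_neg,
    Finset.sum_neg_distrib] at h
  linarith

theorem selectedSign_sq_eq (σ : Fin N → Bool) (i : Fin N) :
    selectedSign u σ i ^ 2 = if i ∈ u σ then 1 else 0 := by
  unfold selectedSign
  split_ifs <;> simp [boolSign_sq]

theorem selectedSign_sq_le_one (σ : Fin N → Bool) (i : Fin N) :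
    selectedSign u σ i ^ 2 ≤ 1 := by
  rw [selectedSign_sq_eq]; split_ifs <;> norm_num

theorem selectedSign_pow_three (σ : Fin N → Bool) (i : Fin N) :
    selectedSign u σ i ^ 3 = selectedSign u σ i := by
  rw [pow_succ, selectedSign_sq_eq, selectedSign]; split_ifs <;> simp

theorem DependsOnComplement.sum_sq (hu : DependsOnComplement u) (s : Finset (Fin N)) :
    ∑ σ, (∑ i ∈ s, selectedSign u σ i) ^ 2 = ∑ σ, ∑ i ∈ s, selectedSign u σ i ^ 2 := by
  induction s using Finset.induction_on with
  | empty => simp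
  | insert i s hi ih =>
    simp only [Finset.sum_insert hi]
    have h := hu.sum_mul_selectedSign hi fun x => x
    calc _ = ∑ σ, selectedSign u σ i ^ 2 + ∑ σ, (∑ j ∈ s, selectedSign u σ j) ^ 2 +
          2 * ∑ σ, (∑ j ∈ s, selectedSign u σ j) * selectedSign u σ i := by
          rw [Finset.mul_sum, ← Finset.sum_add_distrib, ← Finset.sum_add_distrib]
          exact Finset.sum_congr rfl fun σ _ => by ring
      _ = _ := by rw [h, ih, Finset.sum_add_distrib]; ring

/-- In the expansion of `(e + X)^4` the odd terms cancel, since `e^3 = e`; the induction closes by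
`3n² + 6n + 1 ≤ 3(n + 1)²`. -/
theorem DependsOnComplement.sum_pow_four_le (hu : DependsOnComplement u) (s : Finset (Fin N)) :
    ∑ σ, (∑ i ∈ s, selectedSign u σ i) ^ 4 ≤ 3 * (s.card : ℝ) ^ 2 * 2 ^ N := by
  induction s using Finset.induction_on with
  | empty => simp
  | insert i s hi ih =>
    simp only [Finset.sum_insert hi]
    have h1 := hu.sum_mul_selectedSign hi fun x => x
    have h3 := hu.sum_mul_selectedSign hi fun x => x ^ 3
    have hcard : ∑ _σ : Fin N → Bool, (1 : ℝ) = 2 ^ N := by simp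
    have h2 : ∑ σ, (∑ j ∈ s, selectedSign u σ j) ^ 2 ≤ s.card * 2 ^ N := by
      rw [hu.sum_sq]
      calc _ ≤ ∑ σ : Fin N → Bool, ∑ i ∈ s, (1 : ℝ) :=
            Finset.sum_le_sum fun σ _ => Finset.sum_le_sum fun i _ => selectedSign_sq_le_one σ i
        _ = _ := by simp [mul_comm]
    rw [Finset.card_insert_of_notMem hi]
    calc _ ≤ ∑ σ, ((∑ j ∈ s, selectedSign u σ j) ^ 4 + 6 * (∑ j ∈ s, selectedSign u σ j) ^ 2 + 1 +
          4 * ((∑ j ∈ s, selectedSign u σ j) ^ 3 * selectedSign u σ i) +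
          4 * ((∑ j ∈ s, selectedSign u σ j) * selectedSign u σ i)) := by
          refine Finset.sum_le_sum fun σ _ => ?_
          have e3 := selectedSign_pow_three (u := u) σ i
          have e2 := selectedSign_sq_le_one (u := u) σ i
          set e := selectedSign u σ i
          set X := ∑ j ∈ s, selectedSign u σ j
          have e4 : e ^ 4 ≤ 1 := by nlinarith [sq_nonneg e]
          have : (e + X) ^ 4 = X ^ 4 + 6 * (X ^ 2 * e ^ 2) + e ^ 4 + 4 * (X ^ 3 * e) +
            4 * (X * e ^ 3) := by ring
          rw [this, e3]
          have : X ^ 2 * e ^ 2 ≤ X ^ 2 := mul_le_of_le_one_right (sq_nonneg X) e2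
          linarith
      _ ≤ _ := by
          simp only [Finset.sum_add_distrib, ← Finset.mul_sum, h1, h3, hcard]
          push_cast
          have : (0 : ℝ) < 2 ^ N := by positivity
          nlinarith

theorem DependsOnComplement.sum_abs_ge (hu : DependsOnComplement u) (hN : 0 < N)
    (hcard : ∀ σ, (N : ℝ) / 2 ≤ (u σ).card) :
    2 ^ N * (√N / 12) ≤ ∑ σ, |∑ i, selectedSign u σ i| := by
  have hN' : (0 : ℝ) < N := by exact_mod_cast hN
  have h4 := hu.sum_pow_four_le Finset.univ
  have h2 : (N : ℝ) / 2 * 2 ^ N ≤ ∑ σ, (∑ i, selectedSign u σ i) ^ 2 := by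
    rw [hu.sum_sq]
    calc (N : ℝ) / 2 * 2 ^ N = ∑ σ : Fin N → Bool, (N : ℝ) / 2 := by simp [mul_comm]
      _ ≤ _ := by
        refine Finset.sum_le_sum fun σ _ => (hcard σ).trans_eq ?_
        simp [selectedSign_sq_eq]
  rw [Finset.card_univ, Fintype.card_fin] at h4
  -- The scale at which the fourth-moment correction, at most `b / 12` on average, is half of the
  -- second-moment term, at least `b / 6`.
  set b := √(3 * N) with hb
  have hb2 : b ^ 2 = 3 * N := Real.sq_sqrt (by positivity)
  have hb0 : 0 < b := Real.sqrt_pos.2 (by positivity)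
  have hbN : √N ≤ b := Real.sqrt_le_sqrt (by linarith)
  -- After scaling by `b` this is `t² - t⁴/4 ≤ t` for `t ≥ 0`.
  have key : ∀ x : ℝ, x ^ 2 / b - x ^ 4 / (4 * b ^ 3) ≤ |x| := fun x => by
    have hx : x ^ 2 = |x| ^ 2 := (sq_abs x).symm
    have hx4 : x ^ 4 = |x| ^ 4 := by rw [show 4 = 2 * 2 from rfl, pow_mul, pow_mul, hx]
    rw [hx, hx4]
    obtain ⟨t, ht, htx⟩ : ∃ t : ℝ, 0 ≤ t ∧ |x| = t * b := ⟨|x| / b, by positivity, by field_simp⟩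
    rw [htx]
    have : (t * b) ^ 2 / b - (t * b) ^ 4 / (4 * b ^ 3) = (t ^ 2 - t ^ 4 / 4) * b := by
      field_simp
    rw [this]
    refine mul_le_mul_of_nonneg_right ?_ hb0.le
    have h : 0 ≤ 4 - 4 * t + t ^ 3 := by
      nlinarith [mul_nonneg ht (sq_nonneg (t - 1)), sq_nonneg (t - 1)]
    nlinarith [mul_nonneg ht h]
  calc 2 ^ N * (√N / 12) ≤ 2 ^ N * (b / 12) := by gcongr
    _ = (N : ℝ) / 2 * 2 ^ N / b - 3 * (N : ℝ) ^ 2 * 2 ^ N / (4 * b ^ 3) := by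
        have hNb : (N : ℝ) = b ^ 2 / 3 := by rw [hb2]; ring
        rw [hNb]
        field_simp
        ring
    _ ≤ (∑ σ, (∑ i, selectedSign u σ i) ^ 2) / b -
          (∑ σ, (∑ i, selectedSign u σ i) ^ 4) / (4 * b ^ 3) := by gcongr
    _ ≤ _ := by
        rw [Finset.sum_div, Finset.sum_div, ← Finset.sum_sub_distrib]
        exact Finset.sum_le_sum fun σ _ => key _

end SelectedSigns

/-! ### Fooling functions and the lower bound for randomized algorithms -/

section FoolingFunctions

variable {d N : ℕ} (ψ : Fin N → Cube d → ℂ)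

/-- The superposition of the functions `ψ i` with the signs `σ i`. -/
def signedSum (σ : Fin N → Bool) (x : Cube d) : ℂ := ∑ i, (boolSign (σ i) : ℂ) * ψ i x

open Classical in
/-- The indices `i` such that none of the first `n` nodes lies in the support of `ψ i`. -/
def unobserved (A : SamplingAlgorithm d) (n : ℕ) (σ : Fin N → Bool) : Finset (Fin N) :=
  Finset.univ.filter fun i =>
    ∀ k < n, ψ i (A.node (A.samples (signedSum ψ σ) k)) = 0

variable {ψ}

/-- Unobserved summands vanish at each node visited so far, so by induction changing their signs
alters neither the values nor the next adaptive node. -/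
theorem samples_eq_of_agree (A : SamplingAlgorithm d) {n : ℕ} {σ σ' : Fin N → Bool}
    (h : ∀ i ∉ unobserved ψ A n σ, σ' i = σ i) {k : ℕ} (hk : k ≤ n) :
    A.samples (signedSum ψ σ') k = A.samples (signedSum ψ σ) k := by
  induction k with
  | zero => rfl
  | succ k ih =>
    rw [SamplingAlgorithm.samples, SamplingAlgorithm.samples, ih (by omega)]
    congr 2
    refine Finset.sum_congr rfl fun i _ => ?_
    by_cases hi : i ∈ unobserved ψ A n σ
    · rw [unobserved, Finset.mem_filter] at hi
      rw [hi.2 k (by omega)]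
      simp
    · rw [h i hi]

theorem dependsOnComplement_unobserved (A : SamplingAlgorithm d) (n : ℕ) :
    DependsOnComplement (unobserved ψ A n) := fun σ σ' h => by
  unfold unobserved
  refine Finset.filter_congr fun i _ => forall₂_congr fun k hk => ?_
  rw [samples_eq_of_agree A h hk.le]

theorem card_unobserved (hψ : ∀ x i j, ψ i x ≠ 0 → ψ j x ≠ 0 → i = j) (A : SamplingAlgorithm d)
    (n : ℕ) (σ : Fin N → Bool) : N ≤ (unobserved ψ A n σ).card + n := by
  classical
  have hsub : (unobserved ψ A n σ)ᶜ ⊆ (Finset.range n).biUnion fun k =>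
      Finset.univ.filter fun i => ψ i (A.node (A.samples (signedSum ψ σ) k)) ≠ 0 := fun i hi => by
    simpa [unobserved] using hi
  have hc : ((unobserved ψ A n σ)ᶜ).card ≤ n := by
    refine (Finset.card_le_card hsub).trans (Finset.card_biUnion_le.trans ?_)
    calc _ ≤ ∑ _k ∈ Finset.range n, 1 := by
          refine Finset.sum_le_sum fun k _ => Finset.card_le_one.2 fun i hi j hj => ?_
          exact hψ _ i j (Finset.mem_filter.1 hi).2 (Finset.mem_filter.1 hj).2
      _ = n := by simp
  have := Finset.card_add_card_compl (unobserved ψ A n σ)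
  rw [Fintype.card_fin] at this
  omega

/-- Flipping all unobserved signs is an involution that keeps the output and moves the integral by
`2c` times the sum of selected signs. By the triangle inequality the two errors add up to at least
that distance. -/
theorem sum_error_signedSum_ge (hψ : ∀ x i j, ψ i x ≠ 0 → ψ j x ≠ 0 → i = j) {c : ℝ} (hc : 0 ≤ c)
    (hint : ∀ σ, cubeIntegral (signedSum ψ σ) = c * ∑ i, (boolSign (σ i) : ℂ))
    (A : SamplingAlgorithm d) {n : ℕ} (hN : 0 < N) (hn : 2 * n ≤ N) :
    2 ^ N * (c * (√N / 12)) ≤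
      ∑ σ, ‖A.result n (signedSum ψ σ) - cubeIntegral (signedSum ψ σ)‖ := by
  set u := unobserved ψ A n with hudef
  have hu : DependsOnComplement u := dependsOnComplement_unobserved A n
  have h1 := hu.sum_abs_ge hN fun σ => by
    have h := card_unobserved hψ A n σ
    rw [← hudef] at h
    have h' : N ≤ 2 * (u σ).card := by omega
    have h'' : (N : ℝ) ≤ 2 * (u σ).card := by exact_mod_cast h'
    linarith
  have h2 := hu.sum_comp_flipSelected Finset.univ fun σ =>
    ‖A.result n (signedSum ψ σ) - cubeIntegral (signedSum ψ σ)‖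
  have h3 : ∀ σ, 2 * (c * |∑ i, selectedSign u σ i|) ≤
      ‖A.result n (signedSum ψ σ) - cubeIntegral (signedSum ψ σ)‖ +
      ‖A.result n (signedSum ψ (flipSelected u Finset.univ σ)) -
        cubeIntegral (signedSum ψ (flipSelected u Finset.univ σ))‖ := fun σ => by
    have hs : A.result n (signedSum ψ (flipSelected u Finset.univ σ)) =
        A.result n (signedSum ψ σ) := by
      unfold SamplingAlgorithm.result
      rw [samples_eq_of_agree A (fun i hi => ?_) le_rfl]
      simp [flipSelected, hudef, hi]
    have hd : ∀ i, boolSign (σ i) - boolSign (flipSelected u Finset.univ σ i) =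
        2 * selectedSign u σ i := fun i => by
      by_cases hi : i ∈ u σ
      · simp [flipSelected, selectedSign, hi, boolSign_not]; ring
      · simp [flipSelected, selectedSign, hi]
    have hdiff : cubeIntegral (signedSum ψ σ) -
        cubeIntegral (signedSum ψ (flipSelected u Finset.univ σ)) =
        ((2 * (c * ∑ i, selectedSign u σ i) : ℝ) : ℂ) := by
      rw [hint, hint, ← mul_sub, ← Finset.sum_sub_distrib]
      simp only [← Complex.ofReal_sub, hd]
      push_cast
      rw [← Finset.mul_sum]
      ring
    rw [hs]
    calc _ = ‖((2 * (c * ∑ i, selectedSign u σ i) : ℝ) : ℂ)‖ := by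
          rw [Complex.norm_real, Real.norm_eq_abs, abs_mul, abs_mul, abs_of_nonneg hc, abs_two]
      _ = ‖(A.result n (signedSum ψ σ) -
            cubeIntegral (signedSum ψ (flipSelected u Finset.univ σ))) -
            (A.result n (signedSum ψ σ) - cubeIntegral (signedSum ψ σ))‖ := by
          rw [← hdiff]; congr 1; ring
      _ ≤ _ := by rw [add_comm]; exact norm_sub_le _ _
  have h4 := Finset.sum_le_sum fun σ (_ : σ ∈ Finset.univ) => h3 σ
  rw [Finset.sum_add_distrib, h2, ← Finset.mul_sum, ← Finset.mul_sum] at h4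
  have h5 := mul_le_mul_of_nonneg_left h1 hc
  linarith

/-- The worst case dominates the average over signs; exchanging that average with the expectation
reduces to a fixed deterministic algorithm. -/
theorem randomizedError_ge (hψ : ∀ x i j, ψ i x ≠ 0 → ψ j x ≠ 0 → i = j) {c : ℝ} (hc : 0 ≤ c)
    (hint : ∀ σ, cubeIntegral (signedSum ψ σ) = c * ∑ i, (boolSign (σ i) : ℂ))
    {α : ℝ} {γ : ℕ → ℝ} (hmem : ∀ σ, signedSum ψ σ ∈ sobolevSpace d α γ)
    (hnorm : ∀ σ, sobolevNorm α γ (signedSum ψ σ) ≤ 1) {n : ℕ} (hN : 0 < N) (hn : 2 * n ≤ N)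
    (R : RandomizedAlgorithm d n (sobolevSpace d α γ)) :
    ENNReal.ofReal (c * (√N / 12)) ≤ randomizedError α γ R := by
  let _ := R.measurableSpace
  have := R.isProbabilityMeasure
  set P := R.P
  have h1 : ∀ σ, ∫⁻ ω, ‖(R.algorithm ω).result n (signedSum ψ σ) -
      cubeIntegral (signedSum ψ σ)‖ₑ ∂P ≤ randomizedError α γ R := fun σ =>
    le_iSup₂_of_le (signedSum ψ σ) ⟨hmem σ, hnorm σ⟩ le_rfl
  have h2 := Finset.sum_le_sum fun σ (_ : σ ∈ Finset.univ) => h1 σ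
  rw [← lintegral_finsetSum' _ fun σ _ =>
    ((R.aemeasurable_result _ (hmem σ)).sub_const _).enorm] at h2
  have h3 : ENNReal.ofReal (2 ^ N * (c * (√N / 12))) ≤
      ∫⁻ ω, ∑ σ, ‖(R.algorithm ω).result n (signedSum ψ σ) -
        cubeIntegral (signedSum ψ σ)‖ₑ ∂P := by
    calc _ = ∫⁻ _ω, ENNReal.ofReal (2 ^ N * (c * (√N / 12))) ∂P := by simp
      _ ≤ _ := lintegral_mono fun ω => by
        simp only [← ofReal_norm]
        rw [← ENNReal.ofReal_sum_of_nonneg fun _ _ => norm_nonneg _]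
        exact ENNReal.ofReal_le_ofReal
          (sum_error_signedSum_ge hψ hc hint (R.algorithm ω) hN hn)
  have h4 := h3.trans h2
  rw [ENNReal.ofReal_mul (by positivity), Finset.sum_const, Finset.card_univ, nsmul_eq_mul] at h4
  have h5 : ENNReal.ofReal (2 ^ N) = ((Fintype.card (Fin N → Bool) : ℕ) : ℝ≥0∞) := by
    rw [Fintype.card_fun, Fintype.card_bool, Fintype.card_fin, ← ENNReal.ofReal_natCast]
    simp
  rw [h5] at h4
  exact (ENNReal.mul_le_mul_iff_right (by simp) (by simp)).1 h4

end FoolingFunctions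

/-! ### Sobolev norms of smooth functions of one variable -/

open scoped ContDiff FourierTransform

section OneDimensional

theorem integral_cube_one (F : ℝ → ℂ) :
    ∫ x : Cube 1, F (x 0) = ∫ y in Set.Icc (0 : ℝ) 1, F y := by
  rw [← integral_subtype measurableSet_Icc]
  exact (volume_preserving_funUnique (Fin 1) unitInterval).integral_comp'
    (fun y : unitInterval => F y)

theorem fourierCoefficient_eq_fourier {g : ℝ → ℂ} (hg : Function.support g ⊆ Set.Icc 0 1)
    (h : Fin 1 → ℤ) : fourierCoefficient (fun x : Cube 1 => g (x 0)) h = 𝓕 g (h 0 : ℝ) := by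
  unfold fourierCoefficient
  simp only [Fin.sum_univ_one]
  rw [integral_cube_one fun y => g y *
      Complex.exp (-(2 * Real.pi * Complex.I * ((h 0 : ℂ) * (y : ℂ)))),
    setIntegral_eq_integral_of_forall_compl_eq_zero, Real.fourier_real_eq_integral_exp_smul]
  · refine integral_congr_ae (.of_forall fun y => ?_)
    simp only [smul_eq_mul]
    rw [mul_comm]
    congr 2
    push_cast
    ring
  · intro y hy
    rw [Function.notMem_support.1 fun hy' => hy (hg hy'), zero_mul]

theorem tsum_enorm_sq_fourierCoefficient_le {g : ℝ → ℂ} (hg : Continuous g) {b : ℝ}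
    (hb : ∀ y, ‖g y‖ ≤ b) :
    ∑' h, ‖fourierCoefficient (fun x : Cube 1 => g (x 0)) h‖ₑ ^ 2 ≤ ENNReal.ofReal b ^ 2 := by
  have hc : Continuous fun x : Cube 1 => g (x 0) := by fun_prop
  rw [tsum_enorm_sq_fourierCoefficient
    (MemLp.of_bound hc.aestronglyMeasurable b (.of_forall fun x => hb _))]
  calc _ ≤ ∫⁻ _x : Cube 1, ENNReal.ofReal b ^ 2 := by
        refine lintegral_mono fun x => ?_
        rw [← ofReal_norm]
        gcongr
        exact hb _
    _ = _ := by simp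

/-- Replaces the possibly fractional power `α` by an integer `k ≥ α`, so that at scale `N` the norm
is controlled by the function and its `k`-th derivative. -/
theorem weight₁_sq_le {α γ N : ℝ} (hα : 0 ≤ α) (hγ : 0 < γ) (hγ1 : γ ≤ 1) (hN : 1 ≤ N) {k : ℕ}
    (hk : α ≤ k) (h : ℤ) :
    weight₁ α γ h ^ 2 ≤ (N ^ α / γ) ^ 2 * (1 + (|(h : ℝ)| / N) ^ (2 * k)) := by
  have hN0 : 0 < N := by linarith
  have hNα : 1 ≤ N ^ α := Real.one_le_rpow hN hα
  have hW : 1 ≤ N ^ α / γ := by rw [one_le_div hγ]; linarith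
  have hq : 0 ≤ (|(h : ℝ)| / N) ^ (2 * k) := by positivity
  by_cases h0 : h = 0
  · rw [weight₁, if_pos h0]
    have : 1 ≤ (N ^ α / γ) ^ 2 := one_le_pow₀ hW
    nlinarith
  have hh : 1 ≤ |(h : ℝ)| := by
    rw [← Int.cast_abs]; exact_mod_cast Int.one_le_abs h0
  have hhα : 1 ≤ |(h : ℝ)| ^ α := Real.one_le_rpow hh hα
  have hw : weight₁ α γ h = |(h : ℝ)| ^ α / γ := by
    rw [weight₁, if_neg h0, max_eq_right]
    rw [one_le_div hγ]; linarith
  set t := |(h : ℝ)| / N with ht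
  have ht0 : 0 ≤ t := by positivity
  have e : |(h : ℝ)| ^ α / γ = N ^ α / γ * t ^ α := by
    have : |(h : ℝ)| = N * t := by rw [ht]; field_simp
    rw [this, Real.mul_rpow hN0.le ht0]; ring
  rw [hw, e, mul_pow]
  gcongr
  rcases le_total t 1 with h1 | h1
  · have : t ^ α ≤ 1 := Real.rpow_le_one ht0 h1 hα
    have : (t ^ α) ^ 2 ≤ 1 := pow_le_one₀ (Real.rpow_nonneg ht0 _) this
    linarith
  · have h2 : t ^ α ≤ t ^ k := by
      rw [← Real.rpow_natCast]; exact Real.rpow_le_rpow_of_exponent_le h1 hk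
    have h3 : (t ^ α) ^ 2 ≤ (t ^ k) ^ 2 := pow_le_pow_left₀ (Real.rpow_nonneg ht0 _) h2 2
    rw [← pow_mul, mul_comm k 2] at h3
    linarith

theorem support_iteratedDeriv_subset_tsupport (g : ℝ → ℂ) (k : ℕ) :
    Function.support (iteratedDeriv k g) ⊆ tsupport g := fun y hy => by
  refine support_iteratedFDeriv_subset (𝕜 := ℝ) k ?_
  rw [Function.mem_support, ← norm_ne_zero_iff, norm_iteratedFDeriv_eq_norm_iteratedDeriv]
  exact norm_ne_zero_iff.2 hy

theorem norm_fourier_iteratedDeriv_ge {g : ℝ → ℂ} (hg : ContDiff ℝ ∞ g)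
    (hsupp : HasCompactSupport g) (k : ℕ) (h : ℤ) :
    |(h : ℝ)| ^ k * ‖𝓕 g (h : ℝ)‖ ≤ ‖𝓕 (iteratedDeriv k g) (h : ℝ)‖ := by
  have hi : ∀ n : ℕ, (n : ℕ∞) ≤ (⊤ : ℕ∞) → Integrable (iteratedDeriv n g) := fun n _ =>
    (hg.continuous_iteratedDeriv n (by exact_mod_cast le_top)).integrable_of_hasCompactSupport
      (HasCompactSupport.of_support_subset_isCompact hsupp
        (support_iteratedDeriv_subset_tsupport g n))
  rw [Real.fourier_iteratedDeriv (N := ⊤) hg hi le_top]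
  rw [norm_smul, norm_pow]
  gcongr
  simp only [norm_mul, Complex.norm_ofNat, Complex.norm_real, Complex.norm_I, mul_one,
    Real.norm_eq_abs, abs_of_pos Real.pi_pos]
  nlinarith [Real.pi_gt_three, abs_nonneg (h : ℝ)]

/-- Parseval is applied to `g` and to its `k`-th derivative; the factor `N ^ k` from differentiation
cancels the scale in `weight₁_sq_le`. -/
theorem sobolevNorm_le_one {α : ℝ} {γ : ℕ → ℝ} (hα : 0 ≤ α) (hγ : 0 < γ 0) (hγ1 : γ 0 ≤ 1)
    {k : ℕ} (hk : α ≤ k) {N : ℝ} (hN : 1 ≤ N) {g : ℝ → ℂ} (hg : ContDiff ℝ ∞ g)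
    (hsupp : tsupport g ⊆ Set.Icc 0 1) {b : ℝ} (h0 : ∀ y, ‖g y‖ ≤ b)
    (hkb : ∀ y, ‖iteratedDeriv k g y‖ ≤ N ^ k * b) (hb : 2 * (N ^ α / γ 0 * b) ^ 2 ≤ 1) :
    sobolevNorm α γ (fun x : Cube 1 => g (x 0)) ≤ 1 := by
  have hN0 : 0 < N := by linarith
  have hb0 : 0 ≤ b := (norm_nonneg _).trans (h0 0)
  have hcs : HasCompactSupport g := isCompact_Icc.of_isClosed_subset isClosed_closure hsupp
  set g' := iteratedDeriv k g with hg'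
  have hg'c : Continuous g' := hg.continuous_iteratedDeriv k (by exact_mod_cast le_top)
  set W := N ^ α / γ 0 with hW
  have hW0 : 0 < W := by positivity
  have hterm : ∀ h : Fin 1 → ℤ,
      (ENNReal.ofReal (weight α γ h) * ‖fourierCoefficient (fun x : Cube 1 => g (x 0)) h‖ₑ) ^ 2 ≤
      ENNReal.ofReal (W ^ 2) * (‖fourierCoefficient (fun x : Cube 1 => g (x 0)) h‖ₑ ^ 2 +
        ENNReal.ofReal ((N⁻¹) ^ (2 * k)) *
          ‖fourierCoefficient (fun x : Cube 1 => g' (x 0)) h‖ₑ ^ 2) := fun h => by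
    rw [fourierCoefficient_eq_fourier (subset_closure.trans hsupp),
      fourierCoefficient_eq_fourier ((support_iteratedDeriv_subset_tsupport g k).trans hsupp)]
    have hF := norm_fourier_iteratedDeriv_ge hg hcs k (h 0)
    have hw := weight₁_sq_le hα hγ hγ1 hN hk (h 0)
    have hwe : weight α γ h = weight₁ α (γ 0) (h 0) := by simp [weight]
    have hwp : 0 ≤ weight₁ α (γ 0) (h 0) := zero_le_one.trans (one_le_weight₁ _ _ _)
    rw [hwe, ← ofReal_norm, ← ofReal_norm, ← ENNReal.ofReal_mul hwp,
      ← ENNReal.ofReal_pow (by positivity), ← ENNReal.ofReal_pow (by positivity),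
      ← ENNReal.ofReal_pow (by positivity), ← ENNReal.ofReal_mul (by positivity),
      ← ENNReal.ofReal_add (by positivity) (by positivity), ← ENNReal.ofReal_mul (by positivity)]
    refine ENNReal.ofReal_le_ofReal ?_
    set c := ‖𝓕 g (h 0 : ℝ)‖
    set c' := ‖𝓕 g' (h 0 : ℝ)‖
    calc (weight₁ α (γ 0) (h 0) * c) ^ 2 = weight₁ α (γ 0) (h 0) ^ 2 * c ^ 2 := by ring
      _ ≤ (W ^ 2 * (1 + (|(h 0 : ℝ)| / N) ^ (2 * k))) * c ^ 2 := by gcongr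
      _ = W ^ 2 * (c ^ 2 + (N⁻¹) ^ (2 * k) * (|(h 0 : ℝ)| ^ k * c) ^ 2) := by
          rw [div_eq_mul_inv, mul_pow, mul_pow, ← pow_mul, mul_comm k 2]; ring
      _ ≤ _ := by gcongr
  unfold sobolevNorm
  refine ENNReal.rpow_le_one ?_ (by norm_num)
  calc _ ≤ _ := ENNReal.tsum_le_tsum hterm
    _ = ENNReal.ofReal (W ^ 2) * (∑' h, ‖fourierCoefficient (fun x : Cube 1 => g (x 0)) h‖ₑ ^ 2 +
          ENNReal.ofReal ((N⁻¹) ^ (2 * k)) *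
            ∑' h, ‖fourierCoefficient (fun x : Cube 1 => g' (x 0)) h‖ₑ ^ 2) := by
        rw [ENNReal.tsum_mul_left, ENNReal.tsum_add, ENNReal.tsum_mul_left]
    _ ≤ ENNReal.ofReal (W ^ 2) * (ENNReal.ofReal b ^ 2 +
          ENNReal.ofReal ((N⁻¹) ^ (2 * k)) * ENNReal.ofReal (N ^ k * b) ^ 2) := by
        gcongr
        · exact tsum_enorm_sq_fourierCoefficient_le hg.continuous h0
        · exact tsum_enorm_sq_fourierCoefficient_le hg'c hkb
    _ = ENNReal.ofReal (2 * (W * b) ^ 2) := by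
        rw [← ENNReal.ofReal_pow (by positivity), ← ENNReal.ofReal_pow (by positivity),
          ← ENNReal.ofReal_mul (by positivity), ← ENNReal.ofReal_add (by positivity)
            (by positivity), ← ENNReal.ofReal_mul (by positivity)]
        congr 1
        rw [mul_pow (N ^ k), ← pow_mul, mul_comm k 2, ← mul_assoc, ← mul_pow,
          inv_mul_cancel₀ hN0.ne']
        ring
    _ ≤ 1 := ENNReal.ofReal_le_one.2 hb

end OneDimensional

/-! ### Signed sums of scaled bumps -/

section Bump

/-- A smooth bump function with support inside the unit interval. -/
def unitBump : ContDiffBump (1 / 2 : ℝ) := ⟨1 / 8, 1 / 4, by norm_num, by norm_num⟩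

/-- The function `unitBump` with values in `ℂ`. -/
def bump (y : ℝ) : ℂ := (unitBump y : ℝ)

theorem contDiff_bump : ContDiff ℝ ∞ bump :=
  Complex.ofRealCLM.contDiff.comp unitBump.contDiff

theorem tsupport_bump_subset : tsupport bump ⊆ Set.Ioo 0 1 := by
  have h1 : tsupport bump ⊆ Metric.closedBall (1 / 2 : ℝ) (1 / 4) := by
    refine closure_minimal (fun y hy => ?_) Metric.isClosed_closedBall
    have : y ∈ Function.support unitBump := fun h => hy (by simp [bump, h])
    rw [unitBump.support_eq] at this
    exact Metric.ball_subset_closedBall this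
  refine h1.trans ?_
  rw [Real.closedBall_eq_Icc]
  exact Set.Icc_subset_Ioo (by norm_num) (by norm_num)

theorem hasCompactSupport_bump : HasCompactSupport bump :=
  isCompact_Icc.of_isClosed_subset isClosed_closure
    (tsupport_bump_subset.trans Set.Ioo_subset_Icc_self)

theorem exists_bound_iteratedDeriv_bump (k : ℕ) : ∃ M : ℝ, ∀ y, ‖iteratedDeriv k bump y‖ ≤ M :=
  (HasCompactSupport.of_support_subset_isCompact hasCompactSupport_bump
    (support_iteratedDeriv_subset_tsupport bump k)).exists_bound_of_continuous
    (contDiff_bump.continuous_iteratedDeriv k (by exact_mod_cast le_top))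

theorem eq_of_scaled_mem_Ioo {N y : ℝ} {i j : ℕ} (hi : N * y - i ∈ Set.Ioo (0 : ℝ) 1)
    (hj : N * y - j ∈ Set.Ioo (0 : ℝ) 1) : i = j := by
  have h1 : (i : ℝ) < j + 1 := by linarith [hi.1, hj.2]
  have h2 : (j : ℝ) < i + 1 := by linarith [hi.2, hj.1]
  have h1' : i < j + 1 := by exact_mod_cast h1
  have h2' : j < i + 1 := by exact_mod_cast h2
  omega

/-- The shifted supports are disjoint, so at most one summand is nonzero and the bound does not grow
with `N`. -/
theorem norm_sum_scaled_le {q : ℝ → ℂ} (hq : Function.support q ⊆ Set.Ioo 0 1) {M : ℝ}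
    (hM : ∀ t, ‖q t‖ ≤ M) {N : ℕ} (s : Fin N → ℂ) {b : ℝ} (hb : 0 ≤ b)
    (hs : ∀ i, ‖s i‖ ≤ b) (y : ℝ) :
    ‖∑ i : Fin N, s i * q (N * y - (i : ℕ))‖ ≤ b * M := by
  by_cases h : ∃ i : Fin N, q (N * y - (i : ℕ)) ≠ 0
  · obtain ⟨i, hi⟩ := h
    rw [Finset.sum_eq_single i]
    · rw [norm_mul]
      exact mul_le_mul (hs i) (hM _) (norm_nonneg _) ((norm_nonneg _).trans (hs i))
    · intro j _ hji
      by_contra hj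
      exact hji (Fin.ext (eq_of_scaled_mem_Ioo (hq (right_ne_zero_of_mul hj)) (hq hi)))
    · simp
  · push Not at h
    simp only [h, mul_zero, Finset.sum_const_zero, norm_zero]
    exact mul_nonneg hb ((norm_nonneg _).trans (hM 0))

/-- The signed superposition of `N` shifted copies of `bump`, scaled to the intervals
`[i / N, (i + 1) / N]`. -/
def bumpSum {N : ℕ} (a : ℝ) (σ : Fin N → Bool) (y : ℝ) : ℂ :=
  ∑ i : Fin N, ((boolSign (σ i) : ℂ) * a) * bump (N * y - (i : ℕ))

variable {N : ℕ} {a : ℝ} (σ : Fin N → Bool)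

theorem contDiff_bumpSum : ContDiff ℝ ∞ (bumpSum a σ) := by
  unfold bumpSum
  refine ContDiff.sum fun i _ => contDiff_const.mul (contDiff_bump.comp ?_)
  fun_prop

theorem iteratedDeriv_bumpSum (k : ℕ) (y : ℝ) :
    iteratedDeriv k (bumpSum a σ) y =
      ∑ i : Fin N, ((boolSign (σ i) : ℂ) * a * (N : ℂ) ^ k) *
        iteratedDeriv k bump (N * y - (i : ℕ)) := by
  have hsub : ∀ i : Fin N, ContDiff ℝ k fun z : ℝ => bump (z - (i : ℕ)) := fun i =>
    (contDiff_bump.of_le (by exact_mod_cast le_top)).comp (by fun_prop)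
  have hcd : ∀ i : Fin N, ContDiff ℝ k fun z : ℝ => bump (N * z - (i : ℕ)) := fun i =>
    (contDiff_bump.of_le (by exact_mod_cast le_top)).comp (by fun_prop)
  unfold bumpSum
  rw [iteratedDeriv_fun_sum fun i _ => (contDiff_const.mul (hcd i)).contDiffAt]
  refine Finset.sum_congr rfl fun i _ => ?_
  rw [iteratedDeriv_const_mul _ (hcd i).contDiffAt]
  have h1 := congrFun (iteratedDeriv_comp_const_smul (hsub i) (N : ℝ)) y
  have h2 := congrFun (iteratedDeriv_comp_sub_const k bump ((i : ℕ) : ℝ)) (N * y)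
  rw [h1, h2, Complex.real_smul]
  push_cast
  ring

theorem support_bumpSum_subset : Function.support (bumpSum a σ) ⊆ Set.Icc 0 1 := fun y hy => by
  obtain ⟨i, -, hi⟩ := Finset.exists_ne_zero_of_sum_ne_zero hy
  have h := tsupport_bump_subset (subset_closure (right_ne_zero_of_mul hi))
  have hN : 0 < N := i.pos
  have hN' : (0 : ℝ) < N := by exact_mod_cast hN
  have hi0 : (0 : ℝ) ≤ (i : ℕ) := by positivity
  have hi1 : ((i : ℕ) : ℝ) + 1 ≤ N := by exact_mod_cast i.2
  have h1 := h.1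
  have h2 := h.2
  constructor
  · by_contra! hy0
    nlinarith
  · by_contra! hy1
    nlinarith

theorem integral_bump_pos : 0 < ∫ y, unitBump y := unitBump.integral_pos

theorem integral_bumpSum (hN : 0 < N) :
    ∫ y, bumpSum a σ y =
      ((a * (∫ y, unitBump y) / N : ℝ) : ℂ) * ∑ i, (boolSign (σ i) : ℂ) := by
  have hN' : (0 : ℝ) < N := by exact_mod_cast hN
  have hb : ∫ y, bump y = ((∫ y, unitBump y : ℝ) : ℂ) := integral_complex_ofReal
  have hint : ∀ i : Fin N, ∫ y : ℝ, bump (N * y - (i : ℕ)) =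
      (((∫ y, unitBump y) / N : ℝ) : ℂ) := fun i => by
    have h1 := Measure.integral_comp_mul_left (fun z : ℝ => bump (z - (i : ℕ))) (N : ℝ)
    rw [integral_sub_right_eq_self bump, hb] at h1
    rw [h1, abs_of_pos (by positivity), Complex.real_smul]
    push_cast
    ring
  have hi : ∀ i : Fin N, Integrable fun y : ℝ => bump (N * y - (i : ℕ)) := fun i => by
    have h1 : Integrable fun z : ℝ => bump (z - (i : ℕ)) :=
      (contDiff_bump.continuous.integrable_of_hasCompactSupport
        hasCompactSupport_bump).comp_sub_right _
    exact h1.comp_mul_left' hN'.ne'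
  unfold bumpSum
  rw [integral_finsetSum _ fun i _ => (hi i).const_mul _]
  simp only [integral_const_mul, hint]
  rw [Finset.mul_sum]
  refine Finset.sum_congr rfl fun i _ => ?_
  push_cast
  ring

end Bump

/-! ### The lower bound for the exponent -/

theorem exists_randomizedError_ge {α : ℝ} (hα : 0 ≤ α) {γ : ℕ → ℝ} (hγ : 0 < γ 0)
    (hγ1 : γ 0 ≤ 1) : ∃ c : ℝ, 0 < c ∧ ∀ (n : ℕ)
      (R : RandomizedAlgorithm 1 n (sobolevSpace 1 α γ)),
      ENNReal.ofReal (c * (2 * n + 2 : ℝ) ^ (-(α + 1 / 2))) ≤ randomizedError α γ R := by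
  obtain ⟨k, hk⟩ := exists_nat_ge α
  obtain ⟨M0, hM0⟩ := exists_bound_iteratedDeriv_bump 0
  obtain ⟨Mk, hMk⟩ := exists_bound_iteratedDeriv_bump k
  obtain ⟨M, hM, hM0', hMk'⟩ : ∃ M : ℝ, 0 < M ∧ M0 ≤ M ∧ Mk ≤ M :=
    ⟨max 1 (max M0 Mk), by positivity, by simp, by simp⟩
  set J := ∫ y, unitBump y with hJ
  have hJ0 : 0 < J := integral_bump_pos
  refine ⟨γ 0 * J / (24 * M), by positivity, fun n R => ?_⟩
  -- At least twice the number of evaluations, and positive even for `n = 0`.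
  set N := 2 * n + 2 with hN
  have hNpos : 0 < N := by omega
  have hN1 : (1 : ℝ) ≤ N := by exact_mod_cast hNpos
  have hN0 : (0 : ℝ) < N := by linarith
  have hNα : 0 < (N : ℝ) ^ α := by positivity
  -- This height makes `N ^ α / γ 0 * (a * M) = 1 / 2`, which places every signed sum in the unit
  -- ball.
  set a := γ 0 / (2 * M * (N : ℝ) ^ α) with ha
  have ha0 : 0 < a := by positivity
  set ψ : Fin N → Cube 1 → ℂ := fun i x => a * bump (N * (x 0 : ℝ) - (i : ℕ)) with hψ
  have hsum : ∀ σ, signedSum ψ σ = fun x => bumpSum a σ (x 0 : ℝ) := fun σ => by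
    funext x
    simp only [signedSum, bumpSum, hψ, mul_assoc]
  have hcont : ∀ σ, Continuous (signedSum ψ σ) := fun σ => by
    rw [hsum]
    exact (contDiff_bumpSum σ).continuous.comp (by fun_prop)
  have hsign : ∀ (σ : Fin N → Bool) i, ‖(boolSign (σ i) : ℂ) * a‖ ≤ a := fun σ i => by
    rw [norm_mul, Complex.norm_real, Complex.norm_real, Real.norm_eq_abs, abs_boolSign, one_mul,
      Real.norm_of_nonneg ha0.le]
  have hsupp : ∀ j, Function.support (iteratedDeriv j bump) ⊆ Set.Ioo 0 1 := fun j =>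
    (support_iteratedDeriv_subset_tsupport bump j).trans tsupport_bump_subset
  have hbd0 : ∀ (σ : Fin N → Bool) y, ‖bumpSum a σ y‖ ≤ a * M := fun σ y =>
    norm_sum_scaled_le (subset_closure.trans tsupport_bump_subset)
      (fun t => by simpa using (hM0 t).trans hM0') _ ha0.le (hsign σ) y
  have hbdk : ∀ (σ : Fin N → Bool) y, ‖iteratedDeriv k (bumpSum a σ) y‖ ≤ (N : ℝ) ^ k * (a * M) :=
    fun σ y => by
      rw [iteratedDeriv_bumpSum]
      refine (norm_sum_scaled_le (hsupp k) (fun t => (hMk t).trans hMk') _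
        (b := a * (N : ℝ) ^ k) (by positivity) (fun i => ?_) y).trans_eq (by ring)
      rw [norm_mul, norm_pow, Complex.norm_natCast]
      gcongr
      exact hsign σ i
  have hnorm : ∀ σ, sobolevNorm α γ (signedSum ψ σ) ≤ 1 := fun σ => by
    rw [hsum]
    refine sobolevNorm_le_one hα hγ hγ1 hk hN1 (contDiff_bumpSum σ)
      (closure_minimal (support_bumpSum_subset σ) isClosed_Icc) (hbd0 σ) (hbdk σ) ?_
    have : (N : ℝ) ^ α / γ 0 * (a * M) = 1 / 2 := by
      rw [ha]; field_simp
    rw [this]; norm_num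
  have hmem : ∀ σ, signedSum ψ σ ∈ sobolevSpace 1 α γ := fun σ =>
    ⟨MemLp.of_bound (hcont σ).aestronglyMeasurable (a * M) (.of_forall fun x => by
      rw [hsum]; exact hbd0 σ _), (hnorm σ).trans_lt (by simp), fun _ => hcont σ⟩
  have hint : ∀ σ, cubeIntegral (signedSum ψ σ) =
      ((a * J / N : ℝ) : ℂ) * ∑ i, (boolSign (σ i) : ℂ) := fun σ => by
    rw [hsum, cubeIntegral, integral_cube_one,
      setIntegral_eq_integral_of_forall_compl_eq_zero fun y hy =>
        Function.notMem_support.1 fun hy' => hy (support_bumpSum_subset σ hy'),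
      integral_bumpSum σ hNpos]
  have hdisj : ∀ x i j, ψ i x ≠ 0 → ψ j x ≠ 0 → i = j := fun x i j hi hj =>
    Fin.ext (eq_of_scaled_mem_Ioo
      (tsupport_bump_subset (subset_closure (right_ne_zero_of_mul hi)))
      (tsupport_bump_subset (subset_closure (right_ne_zero_of_mul hj))))
  refine le_trans (ENNReal.ofReal_le_ofReal (le_of_eq ?_))
    (randomizedError_ge hdisj (by positivity) hint hmem hnorm hNpos (by omega) R)
  have e1 : (2 * n + 2 : ℝ) = N := by rw [hN]; push_cast; ring
  have e2 : (N : ℝ) ^ (-(α + 1 / 2)) = ((N : ℝ) ^ α)⁻¹ * (√N)⁻¹ := by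
    rw [Real.rpow_neg hN0.le, Real.rpow_add hN0, mul_inv, Real.sqrt_eq_rpow]
  have e3 : √(N : ℝ) ^ 2 = N := Real.sq_sqrt hN0.le
  have hs : 0 < √(N : ℝ) := Real.sqrt_pos.2 hN0
  rw [e1, e2, ha]
  field_simp
  rw [e3]
  ring

theorem exists_algorithm_of_informationComplexity_le {α ε X : ℝ} (hX : 0 ≤ X) {γ : ℕ → ℝ} {d : ℕ}
    (h : (informationComplexity α γ ε d : ℝ≥0∞) ≤ ENNReal.ofReal X) :
    ∃ n : ℕ, (n : ℝ) ≤ X ∧ ∃ A : RandomizedAlgorithm d n (sobolevSpace d α γ),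
      randomizedError α γ A ≤ ENNReal.ofReal ε := by
  by_contra! hcon
  have h1 : ((⌊X⌋₊ + 1 : ℕ) : ℕ∞) ≤ informationComplexity α γ ε d := by
    refine le_iInf₂ fun n hn => ?_
    obtain ⟨A, hA⟩ := hn
    by_contra! hlt
    have hn' : n ≤ ⌊X⌋₊ := by
      have : n < ⌊X⌋₊ + 1 := by exact_mod_cast hlt
      omega
    exact absurd hA (not_le.2 (hcon n ((Nat.le_floor_iff hX).1 hn') A))
  have h2 := (ENat.toENNReal_le.2 h1).trans h
  rw [ENat.toENNReal_coe, ← ENNReal.ofReal_natCast, ENNReal.ofReal_le_ofReal_iff hX] at h2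
  push_cast at h2
  exact absurd h2 (not_le.2 (Nat.lt_floor_add_one X))

theorem one_div_le_of_complexityBound {α : ℝ} (hα : 0 ≤ α) {γ : ℕ → ℝ} (hγ : 0 < γ 0)
    (hγ1 : γ 0 ≤ 1) {p : ℝ≥0} (hp : ComplexityBound α γ p) : 1 / (α + 1 / 2) ≤ (p : ℝ) := by
  by_contra! hlt
  obtain ⟨C, hC, hbound⟩ := hp
  obtain ⟨c, hc, hlow⟩ := exists_randomizedError_ge hα hγ hγ1
  set s := α + 1 / 2 with hs
  have hs0 : 0 < s := by positivity
  have hps : 0 < 1 - p * s := by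
    rw [lt_div_iff₀ hs0] at hlt; linarith
  set c' := c * (2 * C + 2) ^ (-s) with hc'
  have hc'0 : 0 < c' := by positivity
  -- If `p < 1 / s` the exponent on the right is positive, so small `ε` contradicts `c' > 0`; below,
  -- `ε` is chosen so that the right side equals `t ≤ c' / 2`.
  have key : ∀ ε : ℝ, 0 < ε → ε < 1 → c' ≤ ε ^ (1 - p * s) := fun ε hε hε1 => by
    obtain ⟨n, hn, A, hA⟩ := exists_algorithm_of_informationComplexity_le (by positivity)
      (hbound 1 le_rfl ε hε hε1)
    have h1 := (hlow n A).trans hA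
    rw [ENNReal.ofReal_le_ofReal_iff hε.le] at h1
    have h2 : 1 ≤ ε ^ (-(p : ℝ)) :=
      Real.one_le_rpow_of_pos_of_le_one_of_nonpos hε hε1.le (by simp)
    have h3 : (2 * n + 2 : ℝ) ≤ (2 * C + 2) * ε ^ (-(p : ℝ)) := by linarith
    have h4 : c' * ε ^ (p * s) ≤ ε := by
      calc c' * ε ^ (p * s) = c * ((2 * C + 2) * ε ^ (-(p : ℝ))) ^ (-s) := by
            rw [Real.mul_rpow (by positivity) (by positivity), ← Real.rpow_mul hε.le, hc']
            ring_nf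
        _ ≤ c * (2 * n + 2 : ℝ) ^ (-s) := by
            exact mul_le_mul_of_nonneg_left (Real.rpow_le_rpow_of_nonpos (by positivity) h3
              (neg_nonpos.2 hs0.le)) hc.le
        _ ≤ ε := h1
    rw [Real.rpow_sub hε, Real.rpow_one, le_div_iff₀ (by positivity)]
    exact h4
  set t := min (c' / 2) (1 / 2) with ht
  have ht0 : 0 < t := by positivity
  have ht1 : t < 1 := (min_le_right _ _).trans_lt (by norm_num)
  have h := key (t ^ (1 / (1 - p * s))) (by positivity)
    (Real.rpow_lt_one ht0.le ht1 (by positivity))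
  rw [← Real.rpow_mul ht0.le, one_div_mul_cancel hps.ne', Real.rpow_one] at h
  linarith [min_le_left (c' / 2) (1 / 2)]

theorem le_strongTractabilityExponent {α : ℝ} (hα : 0 ≤ α) {γ : ℕ → ℝ} (hγ : 0 < γ 0)
    (hγ1 : γ 0 ≤ 1) : 1 / (ENNReal.ofReal α + 1 / 2) ≤ strongTractabilityExponent α γ := by
  refine le_iInf₂ fun p hp => ?_
  have h := ENNReal.ofReal_le_ofReal (one_div_le_of_complexityBound hα hγ hγ1 hp)
  rw [ENNReal.ofReal_coe_nnreal] at h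
  refine le_trans (le_of_eq ?_) h
  rw [one_div, one_div (α + 1 / 2), ENNReal.ofReal_inv_of_pos (by positivity),
    ENNReal.ofReal_add hα (by norm_num), ENNReal.ofReal_div_of_pos two_pos]
  simp

end WeightedIntegration

end

theorem theorem4 (α : ℝ) (hα : 0 ≤ α) (γ : ℕ → ℝ) (hγ_anti : Antitone γ)
    (hγ_pos : ∀ j, 0 < γ j) (hγ_le : ∀ j, γ j ≤ 1) :
    WeightedIntegration.StronglyTractable α γ ∧
    WeightedIntegration.strongTractabilityExponent α γ ∈
      Set.Icc (1 / (ENNReal.ofReal α + 1 / 2))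
        (max (1 / (WeightedIntegration.summabilityIndex γ + 1 / 2))
          (1 / (ENNReal.ofReal α + 1 / 2))) ∧
    (ENNReal.ofReal α ≤ WeightedIntegration.summabilityIndex γ →
      WeightedIntegration.strongTractabilityExponent α γ = 1 / (ENNReal.ofReal α + 1 / 2)) := by
  have hle := WeightedIntegration.strongTractabilityExponent_le (α := α) hγ_pos hγ_le
  have hge := WeightedIntegration.le_strongTractabilityExponent hα (hγ_pos 0) (hγ_le 0)
  refine ⟨⟨2, WeightedIntegration.complexityBound_two α γ⟩, ⟨hge, hle⟩, fun h => ?_⟩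
  refine le_antisymm (hle.trans_eq (max_eq_right ?_)) hge
  simp only [one_div]
  gcongr
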